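/- Theorem. The following three decision problems are inter-reducible, i.e. for any two of them, each is many-one reducible to the other by a computable function on (encoded) instances. In all instances, rational numbers are given as pairs of a numerator and a positive denominator. (1) Positivity problem: given a square integer matrix $M$ (of dimension at least $2$), decide whether there exists an integer $t \ge 1$ such that $(M^t)_{1,2} > 0$. (2) Markov reachability problem with strict inequality: given a square stochastic matrix $M$ with rational entries (of dimension at least $2$; entries are nonnegative and each row sums to $1$) and a rational number $r > 0$, decide whether there exists an integer $t \ge 1$ such that $(M^t)_{1,2} > r$. (3) Exact value problem with expected stopping time: given a Markov chain $\langle M, \mu, w\rangle$, consisting of an $n \times n$ rational stochastic matrix $M$, a rational initial distribution $\mu$ (a probability vector of length $n$), and a vector $w \in \mathbb{Q}^n$ of rewards, and given a rational stopping time $T$ and a rational threshold $\theta$, decide whether $\mathrm{val}(M,T) < \theta$. Here $$\mathrm{val}(M,T) = \inf_{\delta} \sum_{t=0}^{\infty} \delta(t)\, u_t, \qquad u_t = \sum_{i=0}^{t} \mu\, M^i\, w^{\top},$$ where the infimum ranges over all functions $\delta : \mathbb{N} \to [0,1]$ with $\sum_{t} \delta(t) = 1$ and expected time $\sum_{t}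 t\,\delta(t) = T$ (and $\inf \emptyset = +\infty$, which occurs only for $T < 0$). -/

import Mathlib

/-! ### Codes of problem instances

Rational numbers are encoded as pairs (numerator, denominator), vectors as lists of
entries and matrices as lists of rows. The code types below are `Primcodable`, so Mathlib's
computable functions and many-one reductions apply to predicates on them. -/

/-- Codes of rational numbers: a numerator and a denominator. -/
abbrev RatCode : Type := ℤ × ℕ

/-- The pair `(p, q)` denotes the rational `p / q`, provided that `q > 0`. -/
def RatCode.Denotes (c : RatCode) (x : ℚ) : Prop :=
  0 < c.2 ∧ x = (c.1 : ℚ) / (c.2 : ℚ)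

/-- Codes of rational vectors. -/
abbrev VecCode : Type := List RatCode

/-- The list `c` has exactly `n` entries, and they denote the coordinates of `v`, in order. -/
def VecCode.Denotes (c : VecCode) {n : ℕ} (v : Fin n → ℚ) : Prop :=
  List.Forall₂ RatCode.Denotes c (List.ofFn v)

/-- Codes of square rational matrices, row by row. -/
abbrev MatCode : Type := List (List RatCode)

/-- The list `c` has exactly `n` rows of `n` entries, and they denote the entries of `M`. -/
def MatCode.Denotes (c : MatCode) {n : ℕ} (M : Matrix (Fin n) (Fin n) ℚ) : Prop :=
  List.Forall₂ (List.Forall₂ RatCode.Denotes) c (List.ofFn fun i => List.ofFn fun j => M i j)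

/-- Codes of square integer matrices, row by row. -/
abbrev IntMatCode : Type := List (List ℤ)

/-- The list `c` lists the rows of `M`. -/
def IntMatCode.Denotes (c : IntMatCode) {n : ℕ} (M : Matrix (Fin n) (Fin n) ℤ) : Prop :=
  c = List.ofFn fun i => List.ofFn fun j => M i j

/-! ### The Positivity problem -/

/-- The answer to the Positivity problem for an integer matrix (of dimension at least 2, as the
entry in row 1 and column 2 is considered): is `(M ^ t)₁₂ > 0` for some integer `t ≥ 1`? -/
def PositivityYes {n : ℕ} (M : Matrix (Fin (n + 2)) (Fin (n + 2)) ℤ) : Prop :=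
  ∃ t : ℕ, 1 ≤ t ∧ 0 < (M ^ t) 0 1

/-- The Positivity problem, as the set of codes of its positive instances. -/
def PositivityProblem (c : IntMatCode) : Prop :=
  ∃ (n : ℕ) (M : Matrix (Fin (n + 2)) (Fin (n + 2)) ℤ), c.Denotes M ∧ PositivityYes M

/-! ### The Markov reachability problem with strict inequality -/

/-- The answer to the Markov reachability problem with strict inequality:
is `(M ^ t)₁₂ > r` for some integer `t ≥ 1`? -/
def MarkovReachabilityYes {n : ℕ} (M : Matrix (Fin (n + 2)) (Fin (n + 2)) ℚ) (r : ℚ) : Prop :=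
  ∃ t : ℕ, 1 ≤ t ∧ r < (M ^ t) 0 1

/-- The Markov reachability problem with strict inequality (for a stochastic matrix and a
positive rational threshold), as the set of codes of its positive instances. -/
def MarkovReachabilityProblem (c : MatCode × RatCode) : Prop :=
  ∃ (n : ℕ) (M : Matrix (Fin (n + 2)) (Fin (n + 2)) ℚ) (r : ℚ),
    c.1.Denotes M ∧ c.2.Denotes r ∧ M ∈ Matrix.rowStochastic ℚ (Fin (n + 2)) ∧ 0 < r ∧
    MarkovReachabilityYes M r

/-! ### The exact value problem with expected stopping time -/

/-- A Markov chain with `n` vertices, with rational transition matrix, rational initial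
distribution and rational weights. -/
structure MarkovChain (n : ℕ) where
  /-- transition matrix -/
  M : Matrix (Fin n) (Fin n) ℚ
  /-- initial distribution -/
  μ : Fin n → ℚ
  /-- weights (rewards) -/
  w : Fin n → ℚ
  stochastic : M ∈ Matrix.rowStochastic ℚ (Fin n)
  μ_nonneg : ∀ i, 0 ≤ μ i
  μ_sum : ∑ i, μ i = 1

/-- The utility `u_t = ∑_{i=0}^{t} μ · M^i · wᵀ`: the expected total reward collected up to and
including time `t`. -/
def MarkovChain.utility {n : ℕ} (C : MarkovChain n) (t : ℕ) : ℚ :=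
  ∑ i ∈ Finset.range (t + 1), Matrix.vecMul C.μ (C.M ^ i) ⬝ᵥ C.w

/-- A stopping-time distribution: a probability distribution on `ℕ`. -/
structure StoppingDistribution where
  /-- probability of stopping at time `t` -/
  prob : ℕ → ℝ
  nonneg : ∀ t, 0 ≤ prob t
  hasSum_one : HasSum prob 1

/-- The expected time of `δ` exists (is finite) and is equal to `T`. -/
def StoppingDistribution.HasExpectedTime (δ : StoppingDistribution) (T : ℝ) : Prop :=
  HasSum (fun t : ℕ => (t : ℝ) * δ.prob t) T

/-- The expected utility of the sequence `u` under `δ`. For utilities of a Markov chain and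
`δ` of finite expected time, the series is absolutely convergent, as `|u_t| ≤ (t + 1) * ‖w‖`. -/
noncomputable def StoppingDistribution.expectedUtility (δ : StoppingDistribution)
    (u : ℕ → ℝ) : ℝ :=
  ∑' t : ℕ, u t * δ.prob t

/-- The optimal expected value of a Markov chain with expected stopping time `T`: the infimum of
the expected total reward over all stopping-time distributions with expected time `T`. It is a
real number when `T ≥ 0`, and `+∞` (infimum of the empty set) when `T < 0`. -/
noncomputable def MarkovChain.val {n : ℕ} (C : MarkovChain n) (T : ℝ) : EReal :=
  ⨅ (δ : StoppingDistribution) (_ : δ.HasExpectedTime T),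
    ((δ.expectedUtility fun t => (C.utility t : ℝ) : ℝ) : EReal)

/-- Codes of instances of the exact value problem: transition matrix, initial distribution,
weights, expected stopping time, threshold. -/
abbrev ExactValueCode : Type := MatCode × VecCode × VecCode × RatCode × RatCode

/-- The exact value problem with expected stopping time (is `val(M, T) < θ`?), as the set of
codes of its positive instances. -/
def ExactValueProblem (c : ExactValueCode) : Prop :=
  ∃ (n : ℕ) (C : MarkovChain n) (T θ : ℚ),
    c.1.Denotes C.M ∧ c.2.1.Denotes C.μ ∧ c.2.2.1.Denotes C.w ∧
    c.2.2.2.1.Denotes T ∧ c.2.2.2.2.Denotes θ ∧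
    C.val (T : ℝ) < ((θ : ℝ) : EReal)

/-!
The three problems are equivalent because of a cycle of reductions, from Positivity to Markov
reachability, to the exact value problem, and back to Positivity. Each is a primitive recursive
function that checks the validity of a code and sends invalid codes to invalid codes.

*Positivity to reachability.* For an integer matrix `M` of dimension `N` let `J` be the all-ones
matrix and `D` a bound for the absolute values of the entries. With `A = J / N` and `B = M / (N D)`,
the matrix `P = ½ [A + B, A - B; A - B, A + B]` is stochastic, and it is conjugate to the block
diagonal matrix of `A` and `B`. Hence `P ^ t` has the same shape, with `A ^ t = A` and `B ^ t` in
place of `A` and `B` (`doubledMatrix_pow_succ`), and its entry `(1, 2)` exceeds `1 / (2 N)` exactly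
if the one of `M ^ t` is positive (`positivityYes_iff`).

*Reachability to exact value.* With `e` the second unit vector, the rewards `(I - M) e` telescope:
a chain that collects them has utilities which differ from `-(M ^ t)₁₂` by a constant. Two extra
vertices in front set `u_0 = 0` and `u_t = r - (M ^ t)₁₂` for `t ≥ 1` (`reachabilityChain`). Mixing
time `0` with a time `t` of negative utility gives `val(1) < 0`, and if all utilities are
nonnegative then so is `val(1)`.

*Exact value to Positivity.* The function `T ↦ val(T)` is the lower convex envelope of the
utilities. For `T > 0` let `l` be the largest slope `(θ - u_k) / (T - k)` with `k < T`. The line of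
slope `l` through `(T, θ)` is below the utilities before time `T` and touches one of them, so
`val(T) < θ` exactly if some `u_t` is below the line (`MarkovChain.val_lt_iff`). The difference
between the line and `u_t` is an entry of a power of a rational matrix
(`MarkovChain.differenceMatrix_pow_apply`), and a common denominator is cleared. The slope `l` is
computed from the finitely many utilities before time `T`. For `T = 0` the value is `u_0`, and for
`T < 0` it is infinite.
-/

/-! ### Primitive recursiveness of integer arithmetic and of `zipWith` -/

namespace Primrec

theorem int_ofNat : Primrec (fun n : ℕ => (n : ℤ)) := by
  refine Primrec.encode_iff.1 ?_
  refine (Primrec.nat_mul.comp (Primrec.const 2) Primrec.id).of_eq fun n => ?_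
  rfl

theorem int_negSucc : Primrec Int.negSucc := by
  refine Primrec.encode_iff.1 ?_
  refine (Primrec.nat_add.comp (Primrec.nat_mul.comp (Primrec.const 2) Primrec.id)
    (Primrec.const 1)).of_eq fun n => ?_
  rfl

theorem int_toNat : Primrec Int.toNat := by
  have h : Primrec fun n : ℕ => if n % 2 = 0 then n / 2 else 0 :=
    Primrec.ite (Primrec.eq.comp (Primrec.nat_mod.comp .id (.const 2)) (.const 0))
      (Primrec.nat_div.comp .id (.const 2)) (.const 0)
  refine (h.comp Primrec.encode).of_eq fun z => ?_
  cases z with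
  | ofNat n =>
    have : Encodable.encode (Int.ofNat n) = 2 * n := rfl
    rw [this]; simp
  | negSucc n =>
    have : Encodable.encode (Int.negSucc n) = 2 * n + 1 := rfl
    rw [this]; simp [Nat.add_mod]

/-- Integer arithmetic reduces to natural arithmetic through differences of natural numbers. -/
theorem int_subNat : Primrec₂ (fun a b : ℕ => (a : ℤ) - b) := by
  refine (Primrec.ite (Primrec.nat_le.comp Primrec.snd Primrec.fst)
    (int_ofNat.comp (Primrec.nat_sub.comp Primrec.fst Primrec.snd))
    (int_negSucc.comp (Primrec.nat_sub.comp (Primrec.nat_sub.comp Primrec.snd Primrec.fst)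
      (Primrec.const 1)))).of_eq fun p => ?_
  split_ifs with h
  · dsimp only; omega
  · rw [Int.negSucc_eq]; dsimp only; omega

theorem int_neg_toNat : Primrec (fun z : ℤ => (-z).toNat) := by
  have h : Primrec fun n : ℕ => if n % 2 = 0 then 0 else n / 2 + 1 :=
    Primrec.ite (Primrec.eq.comp (Primrec.nat_mod.comp .id (.const 2)) (.const 0))
      (.const 0) (Primrec.succ.comp (Primrec.nat_div.comp .id (.const 2)))
  refine (h.comp Primrec.encode).of_eq fun z => ?_
  cases z with
  | ofNat n =>
    have : Encodable.encode (Int.ofNat n) = 2 * n := rfl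
    rw [this]; simp
  | negSucc n =>
    have : Encodable.encode (Int.negSucc n) = 2 * n + 1 := rfl
    rw [this, Int.neg_negSucc]
    have h1 : (2 * n + 1) % 2 ≠ 0 := by omega
    have h2 : (2 * n + 1) / 2 = n := by omega
    rw [if_neg h1, h2]; rfl

theorem int_neg : Primrec (fun z : ℤ => -z) :=
  (int_subNat.comp int_neg_toNat int_toNat).of_eq fun z => by omega

theorem int_add : Primrec₂ (fun a b : ℤ => a + b) :=
  (int_subNat.comp
    (Primrec.nat_add.comp (int_toNat.comp .fst) (int_toNat.comp .snd))
    (Primrec.nat_add.comp (int_neg_toNat.comp .fst) (int_neg_toNat.comp .snd))).of_eq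
    fun p => by dsimp only; omega

theorem int_sub : Primrec₂ (fun a b : ℤ => a - b) :=
  (int_add.comp .fst (int_neg.comp .snd)).of_eq fun p => by dsimp only; omega

theorem int_mul : Primrec₂ (fun a b : ℤ => a * b) := by
  refine (int_subNat.comp
    (Primrec.nat_add.comp
      (Primrec.nat_mul.comp (int_toNat.comp .fst) (int_toNat.comp .snd))
      (Primrec.nat_mul.comp (int_neg_toNat.comp .fst) (int_neg_toNat.comp .snd)))
    (Primrec.nat_add.comp
      (Primrec.nat_mul.comp (int_toNat.comp .fst) (int_neg_toNat.comp .snd))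
      (Primrec.nat_mul.comp (int_neg_toNat.comp .fst) (int_toNat.comp .snd)))).of_eq fun p => ?_
  obtain ⟨a, b⟩ := p
  have ha : a = a.toNat - (-a).toNat := by omega
  have hb : b = b.toNat - (-b).toNat := by omega
  push_cast
  conv_rhs => rw [ha, hb]
  ring

theorem int_natAbs : Primrec Int.natAbs :=
  (Primrec.nat_add.comp int_toNat int_neg_toNat).of_eq fun z => by omega

theorem int_le : PrimrecRel (fun a b : ℤ => a ≤ b) :=
  (Primrec.nat_le.comp (int_toNat.comp (int_sub.comp .fst .snd)) (Primrec.const 0)).of_eq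
    fun p => by simp

theorem int_lt : PrimrecRel (fun a b : ℤ => a < b) :=
  (int_le.swap.not).of_eq fun a b => by simp [Function.swap]

theorem list_zipWith {α β γ : Type*} [Primcodable α] [Primcodable β] [Primcodable γ]
    {f : α → β → γ} (hf : Primrec₂ f) : Primrec₂ (List.zipWith f) := by
  have h : Primrec₂ fun (l : List α × List β) (i : ℕ) =>
      (l.1[i]?).bind fun a => (l.2[i]?).map fun b => f a b := by
    refine Primrec.option_bind (Primrec.list_getElem?.comp (Primrec.fst.comp .fst) .snd) ?_
    refine Primrec.option_map
      (Primrec.list_getElem?.comp (Primrec.snd.comp (Primrec.fst.comp .fst))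
        (Primrec.snd.comp .fst)) ?_
    exact hf.comp (Primrec.snd.comp .fst) .snd
  refine (Primrec.listFilterMap (Primrec.list_range.comp (Primrec.list_length.comp .fst))
    h).of_eq ?_
  rintro ⟨l, m⟩
  simp only
  induction l generalizing m with
  | nil => simp
  | cons a l ih =>
    rw [List.length_cons, List.range_succ_eq_map, List.filterMap_cons, List.filterMap_map]
    cases m with
    | nil => simp
    | cons b m =>
      have := ih m
      simpa [Function.comp_def] using this

end Primrec

/-! ### Arithmetic of rational codes -/

namespace RatCode

/-- The code of an integer. -/
def ofInt (z : ℤ) : RatCode := (z, 1)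

/-- Sum of codes (fractions are not reduced). -/
def add (x y : RatCode) : RatCode := (x.1 * (y.2 : ℤ) + y.1 * (x.2 : ℤ), x.2 * y.2)

/-- Difference of codes. -/
def sub (x y : RatCode) : RatCode := (x.1 * (y.2 : ℤ) - y.1 * (x.2 : ℤ), x.2 * y.2)

/-- Product of codes. -/
def mul (x y : RatCode) : RatCode := (x.1 * y.1, x.2 * y.2)

/-- Quotient of codes. It is meant for a positive divisor; otherwise it has denominator `0`. -/
def div (x y : RatCode) : RatCode := (x.1 * (y.2 : ℤ), x.2 * y.1.toNat)

/-- Comparison of codes by cross-multiplication. -/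
abbrev Lt (x y : RatCode) : Prop := x.1 * (y.2 : ℤ) < y.1 * (x.2 : ℤ)

/-- The larger of two codes. -/
def sup (x y : RatCode) : RatCode := if Lt x y then y else x

theorem primrec_ofInt : Primrec ofInt := Primrec.pair .id (.const 1)

theorem primrec_cross : Primrec₂ fun x y : RatCode => x.1 * (y.2 : ℤ) :=
  Primrec.int_mul.comp (Primrec.fst.comp .fst) (Primrec.int_ofNat.comp (Primrec.snd.comp .snd))

theorem primrec_den : Primrec₂ fun x y : RatCode => x.2 * y.2 :=
  Primrec.nat_mul.comp (Primrec.snd.comp .fst) (Primrec.snd.comp .snd)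

theorem primrec_add : Primrec₂ add :=
  Primrec.pair (Primrec.int_add.comp primrec_cross (primrec_cross.comp .snd .fst)) primrec_den

theorem primrec_sub : Primrec₂ sub :=
  Primrec.pair (Primrec.int_sub.comp primrec_cross (primrec_cross.comp .snd .fst)) primrec_den

theorem primrec_mul : Primrec₂ mul :=
  Primrec.pair (Primrec.int_mul.comp (Primrec.fst.comp .fst) (Primrec.fst.comp .snd)) primrec_den

theorem primrec_div : Primrec₂ div :=
  Primrec.pair primrec_cross (Primrec.nat_mul.comp (Primrec.snd.comp .fst)
    (Primrec.int_toNat.comp (Primrec.fst.comp .snd)))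

theorem primrec_lt : PrimrecRel Lt :=
  Primrec.int_lt.comp primrec_cross (primrec_cross.comp .snd .fst)

theorem primrec_sup : Primrec₂ sup := Primrec.ite primrec_lt .snd .fst

variable {a b : RatCode} {x y : ℚ}

theorem Denotes.unique (ha : a.Denotes x) (hb : a.Denotes y) : x = y := ha.2.trans hb.2.symm

theorem denotes_ofInt (z : ℤ) : (ofInt z).Denotes z := ⟨Nat.one_pos, by simp [ofInt]⟩

theorem denotes_zero : (ofInt 0).Denotes 0 := by simpa using denotes_ofInt 0

theorem denotes_one : (ofInt 1).Denotes 1 := by simpa using denotes_ofInt 1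

theorem Denotes.add (ha : a.Denotes x) (hb : b.Denotes y) : (add a b).Denotes (x + y) := by
  obtain ⟨h1, rfl⟩ := ha
  obtain ⟨h2, rfl⟩ := hb
  refine ⟨Nat.mul_pos h1 h2, ?_⟩
  simp only [RatCode.add]; push_cast; field_simp

theorem Denotes.sub (ha : a.Denotes x) (hb : b.Denotes y) : (sub a b).Denotes (x - y) := by
  obtain ⟨h1, rfl⟩ := ha
  obtain ⟨h2, rfl⟩ := hb
  refine ⟨Nat.mul_pos h1 h2, ?_⟩
  simp only [RatCode.sub]; push_cast; field_simp

theorem Denotes.mul (ha : a.Denotes x) (hb : b.Denotes y) : (mul a b).Denotes (x * y) := by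
  obtain ⟨h1, rfl⟩ := ha
  obtain ⟨h2, rfl⟩ := hb
  refine ⟨Nat.mul_pos h1 h2, ?_⟩
  simp only [RatCode.mul]; push_cast; field_simp

theorem Denotes.pos_iff (ha : a.Denotes x) : 0 < x ↔ 0 < a.1 := by
  obtain ⟨h1, rfl⟩ := ha
  have : (0 : ℚ) < a.2 := by exact_mod_cast h1
  rw [lt_div_iff₀ this]; simp

theorem Denotes.nonneg_iff (ha : a.Denotes x) : 0 ≤ x ↔ 0 ≤ a.1 := by
  obtain ⟨h1, rfl⟩ := ha
  have : (0 : ℚ) < a.2 := by exact_mod_cast h1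
  rw [le_div_iff₀ this]; simp

theorem Denotes.zero_iff (ha : a.Denotes x) : x = 0 ↔ a.1 = 0 := by
  obtain ⟨h1, rfl⟩ := ha
  simp [h1.ne']

theorem Denotes.one_iff (ha : a.Denotes x) : x = 1 ↔ a.1 = (a.2 : ℤ) := by
  obtain ⟨h1, rfl⟩ := ha
  have : (a.2 : ℚ) ≠ 0 := by exact_mod_cast h1.ne'
  rw [div_eq_one_iff_eq this]; exact_mod_cast Iff.rfl

theorem Denotes.div (ha : a.Denotes x) (hb : b.Denotes y) (hy : 0 < y) :
    (div a b).Denotes (x / y) := by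
  have hb1 := hb.pos_iff.1 hy
  obtain ⟨h1, rfl⟩ := ha
  obtain ⟨h2, rfl⟩ := hb
  have h3 : ((b.1.toNat : ℕ) : ℤ) = b.1 := Int.toNat_of_nonneg hb1.le
  have h4 : ((b.1.toNat : ℕ) : ℚ) = b.1 := by exact_mod_cast h3
  have h5 : (b.1 : ℚ) ≠ 0 := by exact_mod_cast hb1.ne'
  refine ⟨Nat.mul_pos h1 (by omega), ?_⟩
  simp only [RatCode.div]; push_cast; rw [h4]; field_simp

theorem Denotes.lt_iff (ha : a.Denotes x) (hb : b.Denotes y) : x < y ↔ Lt a b := by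
  obtain ⟨h1, rfl⟩ := ha
  obtain ⟨h2, rfl⟩ := hb
  rw [div_lt_div_iff₀ (by exact_mod_cast h1) (by exact_mod_cast h2)]
  exact_mod_cast Iff.rfl

theorem Denotes.sup (ha : a.Denotes x) (hb : b.Denotes y) : (sup a b).Denotes (max x y) := by
  unfold RatCode.sup
  split_ifs with h
  · rwa [max_eq_right ((ha.lt_iff hb).2 h).le]
  · rwa [max_eq_left (not_lt.1 fun h' => h ((ha.lt_iff hb).1 h'))]

theorem exists_denotes_iff : (∃ x, a.Denotes x) ↔ 0 < a.2 :=
  ⟨fun ⟨_, h⟩ => h.1, fun h => ⟨_, h, rfl⟩⟩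

end RatCode

/-! ### Lists that denote vectors and matrices -/

namespace List

variable {α β γ δ : Type*} {n : ℕ}

theorem forall₂_ofFn_right_iff {R : α → β → Prop} {l : List α} {v : Fin n → β} :
    Forall₂ R l (ofFn v) ↔ ∃ h : l.length = n, ∀ i : Fin n, R (l[i.1]'(h ▸ i.2)) (v i) := by
  rw [forall₂_iff_get]
  constructor
  · rintro ⟨h, H⟩
    rw [length_ofFn] at h
    refine ⟨h, fun i => ?_⟩
    simpa using H i.1 (h ▸ i.2) (by simp)
  · rintro ⟨h, H⟩
    refine ⟨by simpa using h, fun i h1 h2 => ?_⟩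
    simpa using H ⟨i, h ▸ h1⟩

theorem exists_forall₂_ofFn_iff {R : α → β → Prop} {l : List α} :
    (∃ v : Fin n → β, Forall₂ R l (ofFn v)) ↔ l.length = n ∧ ∀ a ∈ l, ∃ b, R a b := by
  constructor
  · rintro ⟨v, h⟩
    obtain ⟨h, H⟩ := forall₂_ofFn_right_iff.1 h
    refine ⟨h, fun a ha => ?_⟩
    obtain ⟨i, hi, rfl⟩ := getElem_of_mem ha
    exact ⟨_, H ⟨i, h ▸ hi⟩⟩
  · rintro ⟨rfl, H⟩
    choose f hf using H
    exact ⟨fun i => f l[i] (getElem_mem _), forall₂_ofFn_right_iff.2 ⟨rfl, fun i => hf _ _⟩⟩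

theorem Forall₂.of_mem_ofFn {R : α → β → Prop} {l : List α} {v : Fin n → β}
    (h : Forall₂ R l (ofFn v)) {a : α} (ha : a ∈ l) : ∃ i, R a (v i) := by
  obtain ⟨h, H⟩ := forall₂_ofFn_right_iff.1 h
  obtain ⟨i, hi, rfl⟩ := getElem_of_mem ha
  exact ⟨_, H ⟨i, h ▸ hi⟩⟩

theorem Forall₂.map_ofFn {R : α → β → Prop} {S : γ → δ → Prop} {l : List α} {v : Fin n → β}
    (h : Forall₂ R l (ofFn v)) {f : α → γ} {g : Fin n → δ}
    (hfg : ∀ a i, R a (v i) → S (f a) (g i)) :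
    Forall₂ S (l.map f) (ofFn g) := by
  obtain ⟨h, H⟩ := forall₂_ofFn_right_iff.1 h
  exact forall₂_ofFn_right_iff.2 ⟨by simpa using h, fun i => by simpa using hfg _ i (H i)⟩

theorem Forall₂.zipWith_ofFn {α' β' : Type*} {R : α → β → Prop} {R' : α' → β' → Prop}
    {S : γ → δ → Prop} {l : List α} {v : Fin n → β} {l' : List α'} {v' : Fin n → β'}
    (h : Forall₂ R l (ofFn v)) (h' : Forall₂ R' l' (ofFn v'))
    {f : α → α' → γ} {g : Fin n → δ} (hfg : ∀ a a' i, R a (v i) → R' a' (v' i) → S (f a a') (g i)) :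
    Forall₂ S (zipWith f l l') (ofFn g) := by
  obtain ⟨h, H⟩ := forall₂_ofFn_right_iff.1 h
  obtain ⟨h', H'⟩ := forall₂_ofFn_right_iff.1 h'
  exact forall₂_ofFn_right_iff.2 ⟨by simp [h, h'], fun i => by simpa using hfg _ _ i (H i) (H' i)⟩

theorem Forall₂.length_eq_ofFn {R : α → β → Prop} {l : List α} {v : Fin n → β}
    (h : Forall₂ R l (ofFn v)) : l.length = n := (forall₂_ofFn_right_iff.1 h).1

theorem Forall₂.cons_ofFn {R : α → β → Prop} {a : α} {b : β} {l : List α} {v : Fin n → β}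
    (h : R a b) (h' : Forall₂ R l (ofFn v)) :
    Forall₂ R (a :: l) (ofFn (Matrix.vecCons b v)) := by
  simp only [ofFn_succ, Matrix.cons_val_zero, Matrix.cons_val_succ]
  exact Forall₂.cons h h'

/-- A relation that determines its right-hand side does so for lists, too. -/
theorem Forall₂.ofFn_unique {R : α → β → Prop} (hR : ∀ a b b', R a b → R a b' → b = b')
    {l : List α} {v v' : Fin n → β} (h : Forall₂ R l (ofFn v)) (h' : Forall₂ R l (ofFn v')) :
    v = v' := by
  obtain ⟨h, H⟩ := forall₂_ofFn_right_iff.1 h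
  obtain ⟨h', H'⟩ := forall₂_ofFn_right_iff.1 h'
  exact funext fun i => hR _ _ _ (H i) (H' i)

end List

theorem VecCode.Denotes.unique {c : VecCode} {n : ℕ} {v v' : Fin n → ℚ}
    (h : c.Denotes v) (h' : c.Denotes v') : v = v' :=
  List.Forall₂.ofFn_unique (R := RatCode.Denotes)
    (fun _ _ _ h h' => RatCode.Denotes.unique h h') h h'

/-- The rows of a code of a matrix denote the rows of the matrix. -/
theorem MatCode.denotes_iff {c : MatCode} {n : ℕ} {M : Matrix (Fin n) (Fin n) ℚ} :
    c.Denotes M ↔ List.Forall₂ (fun (r : VecCode) (v : Fin n → ℚ) => r.Denotes v) c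
      (List.ofFn M) :=
  List.forall₂_ofFn_right_iff.trans (List.forall₂_ofFn_right_iff (R := fun (r : VecCode)
    (v : Fin n → ℚ) => r.Denotes v)).symm

theorem MatCode.Denotes.unique {c : MatCode} {n : ℕ} {M M' : Matrix (Fin n) (Fin n) ℚ}
    (h : c.Denotes M) (h' : c.Denotes M') : M = M' :=
  List.Forall₂.ofFn_unique (R := fun (r : VecCode) (v : Fin n → ℚ) => r.Denotes v)
    (fun _ _ _ h h' => VecCode.Denotes.unique h h') (MatCode.denotes_iff.1 h)
    (MatCode.denotes_iff.1 h')

theorem MatCode.Denotes.length_eq {c : MatCode} {n : ℕ} {M : Matrix (Fin n) (Fin n) ℚ}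
    (h : c.Denotes M) : c.length = n := List.Forall₂.length_eq_ofFn h

theorem IntMatCode.denotes_iff {c : IntMatCode} {n : ℕ} {M : Matrix (Fin n) (Fin n) ℤ} :
    c.Denotes M ↔ List.Forall₂ (fun (r : List ℤ) (v : Fin n → ℤ) => r = List.ofFn v) c
      (List.ofFn M) := by
  refine Iff.trans ?_ (List.forall₂_ofFn_right_iff (R := fun (r : List ℤ)
    (v : Fin n → ℤ) => r = List.ofFn v)).symm
  rw [IntMatCode.Denotes]
  constructor
  · rintro rfl
    exact ⟨by simp, fun i => by simp⟩
  · rintro ⟨h, H⟩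
    refine List.ext_getElem (by simpa using h) fun i h1 h2 => ?_
    simpa using H ⟨i, h ▸ h1⟩

theorem IntMatCode.Denotes.length_eq {c : IntMatCode} {n : ℕ} {M : Matrix (Fin n) (Fin n) ℤ}
    (h : c.Denotes M) : c.length = n := by rw [h]; simp

theorem IntMatCode.Denotes.unique {c : IntMatCode} {n : ℕ} {M M' : Matrix (Fin n) (Fin n) ℤ}
    (h : c.Denotes M) (h' : c.Denotes M') : M = M' :=
  List.Forall₂.ofFn_unique (fun _ _ _ h h' => List.ofFn_injective (h.symm.trans h'))
    (IntMatCode.denotes_iff.1 h) (IntMatCode.denotes_iff.1 h')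

/-! ### Linear algebra on codes -/

/-- Sum of the entries of a coded vector. -/
def VecCode.sum (l : VecCode) : RatCode := l.foldr RatCode.add (RatCode.ofInt 0)

/-- Dot product of coded vectors. -/
def VecCode.dot (l m : VecCode) : RatCode := VecCode.sum (List.zipWith RatCode.mul l m)

/-- Product of a coded matrix and a coded column vector. -/
def MatCode.mulVec (c : MatCode) (l : VecCode) : VecCode := c.map fun r => VecCode.dot r l

theorem VecCode.primrec_sum : Primrec VecCode.sum :=
  Primrec.list_foldr (h := fun _ p => RatCode.add p.1 p.2) .id (.const _)
    (RatCode.primrec_add.comp (Primrec.fst.comp .snd) (Primrec.snd.comp .snd))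

theorem VecCode.primrec_dot : Primrec₂ VecCode.dot :=
  VecCode.primrec_sum.comp (Primrec.list_zipWith RatCode.primrec_mul)

theorem MatCode.primrec_mulVec : Primrec₂ MatCode.mulVec :=
  Primrec.list_map .fst (VecCode.primrec_dot.comp .snd (Primrec.snd.comp .fst))

section
variable {n : ℕ} {l m : VecCode} {v w : Fin n → ℚ} {c : MatCode} {M : Matrix (Fin n) (Fin n) ℚ}

theorem VecCode.Denotes.sum (h : l.Denotes v) : (VecCode.sum l).Denotes (∑ i, v i) := by
  have key : ∀ (l : List RatCode) (l' : List ℚ), List.Forall₂ RatCode.Denotes l l' →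
      (VecCode.sum l).Denotes l'.sum := by
    intro l l' h
    induction h with
    | nil => exact RatCode.denotes_zero
    | cons h _ ih => rw [List.sum_cons]; exact h.add ih
  rw [← List.sum_ofFn]
  exact key _ _ h

theorem VecCode.Denotes.dot (h : l.Denotes v) (h' : m.Denotes w) :
    (VecCode.dot l m).Denotes (v ⬝ᵥ w) :=
  VecCode.Denotes.sum (List.Forall₂.zipWith_ofFn h h' fun _ _ _ ha hb => ha.mul hb)

theorem MatCode.Denotes.mulVec (h : c.Denotes M) (h' : l.Denotes v) :
    VecCode.Denotes (MatCode.mulVec c l) (M.mulVec v) :=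
  List.Forall₂.map_ofFn (MatCode.denotes_iff.1 h) fun _ _ hr => VecCode.Denotes.dot hr h'

theorem VecCode.Denotes.add (h : l.Denotes v) (h' : m.Denotes w) :
    VecCode.Denotes (List.zipWith RatCode.add l m) (v + w) :=
  List.Forall₂.zipWith_ofFn h h' fun _ _ _ ha hb => ha.add hb

theorem VecCode.Denotes.sub (h : l.Denotes v) (h' : m.Denotes w) :
    VecCode.Denotes (List.zipWith RatCode.sub l m) (v - w) :=
  List.Forall₂.zipWith_ofFn h h' fun _ _ _ ha hb => ha.sub hb

theorem VecCode.Denotes.cons {a : RatCode} {x : ℚ} (h : a.Denotes x) (h' : l.Denotes v) :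
    VecCode.Denotes (a :: l) (Matrix.vecCons x v) :=
  List.Forall₂.cons_ofFn h h'

/-- A constant vector is coded by any list of copies of a code of the constant. -/
theorem VecCode.denotes_const_map {α : Type*} {a : RatCode} {x : ℚ} (h : a.Denotes x) {l : List α}
    (hl : l.length = n) : VecCode.Denotes (l.map fun _ => a) (fun _ : Fin n => x) :=
  List.forall₂_ofFn_right_iff.2 ⟨by simpa using hl, fun i => by simpa using h⟩

end

/-! ### Decidable validity of codes -/

/-- The list has `n` entries, and their denominators are positive. -/
abbrev VecCode.IsValid (l : VecCode) (n : ℕ) : Prop := l.length = n ∧ ∀ a ∈ l, 0 < a.2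

/-- The list has `n` entries, and it denotes a probability vector. -/
abbrev VecCode.IsProb (l : VecCode) (n : ℕ) : Prop :=
  l.IsValid n ∧ (∀ a ∈ l, 0 ≤ a.1) ∧ (VecCode.sum l).1 = ((VecCode.sum l).2 : ℤ)

/-- The list denotes a stochastic matrix. -/
abbrev MatCode.IsStochastic (c : MatCode) : Prop := ∀ r ∈ c, VecCode.IsProb r c.length

theorem VecCode.primrec_isValid : PrimrecRel VecCode.IsValid :=
  (Primrec.eq.comp (Primrec.list_length.comp .fst) .snd).and
    (PrimrecPred.forall_mem_list (p := fun a : RatCode => 0 < a.2)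
      (Primrec.nat_lt.comp (.const 0) .snd) |>.comp .fst)

theorem VecCode.primrec_isProb : PrimrecRel VecCode.IsProb :=
  VecCode.primrec_isValid.and
    ((PrimrecPred.forall_mem_list (p := fun a : RatCode => 0 ≤ a.1)
      (Primrec.int_le.comp (.const 0) .fst) |>.comp .fst).and
    (Primrec.eq.comp (Primrec.fst.comp (VecCode.primrec_sum.comp .fst))
      (Primrec.int_ofNat.comp (Primrec.snd.comp (VecCode.primrec_sum.comp .fst)))))

theorem MatCode.primrec_isStochastic : PrimrecPred MatCode.IsStochastic :=
  (PrimrecRel.forall_mem_list VecCode.primrec_isProb).comp .id Primrec.list_length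

theorem VecCode.exists_denotes_iff {l : VecCode} {n : ℕ} :
    (∃ v : Fin n → ℚ, l.Denotes v) ↔ l.IsValid n :=
  List.exists_forall₂_ofFn_iff.trans (and_congr_right fun _ =>
    forall₂_congr fun _ _ => RatCode.exists_denotes_iff)

theorem VecCode.Denotes.isValid {l : VecCode} {n : ℕ} {v : Fin n → ℚ} (h : l.Denotes v) :
    l.IsValid n := VecCode.exists_denotes_iff.1 ⟨v, h⟩

theorem VecCode.Denotes.isProb_iff {l : VecCode} {n : ℕ} {v : Fin n → ℚ} (h : l.Denotes v) :
    l.IsProb n ↔ (∀ i, 0 ≤ v i) ∧ ∑ i, v i = 1 := by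
  rw [VecCode.IsProb, and_iff_right h.isValid, ← h.sum.one_iff]
  refine and_congr_left fun _ => ⟨fun H i => ?_, fun H a ha => ?_⟩
  · obtain ⟨h, H'⟩ := List.forall₂_ofFn_right_iff.1 h
    exact (H' i).nonneg_iff.2 (H _ (List.getElem_mem _))
  · obtain ⟨i, hi⟩ := List.Forall₂.of_mem_ofFn h ha
    exact hi.nonneg_iff.1 (H i)

theorem MatCode.Denotes.isStochastic_iff {c : MatCode} {n : ℕ} {M : Matrix (Fin n) (Fin n) ℚ}
    (h : c.Denotes M) : c.IsStochastic ↔ M ∈ Matrix.rowStochastic ℚ (Fin n) := by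
  have hl := h.length_eq
  subst hl
  rw [Matrix.mem_rowStochastic_iff_sum, ← forall_and]
  have h' := MatCode.denotes_iff.1 h
  constructor
  · intro H i
    obtain ⟨h1, h2⟩ := List.forall₂_ofFn_right_iff.1 h'
    exact (h2 i).isProb_iff.1 (H _ (List.getElem_mem _))
  · intro H r hr
    obtain ⟨i, hi⟩ := List.Forall₂.of_mem_ofFn h' hr
    exact hi.isProb_iff.2 (H i)

theorem MatCode.IsStochastic.exists_denotes {c : MatCode} (h : c.IsStochastic) {n : ℕ}
    (hn : c.length = n) : ∃ M : Matrix (Fin n) (Fin n) ℚ, c.Denotes M := by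
  subst hn
  simp only [MatCode.denotes_iff]
  exact List.exists_forall₂_ofFn_iff.2 ⟨rfl, fun r hr => VecCode.exists_denotes_iff.2 (h r hr).1⟩

/-! ### The problems on valid codes -/

theorem positivityProblem_iff {c : IntMatCode} {n : ℕ} {M : Matrix (Fin (n + 2)) (Fin (n + 2)) ℤ}
    (h : c.Denotes M) : PositivityProblem c ↔ PositivityYes M := by
  refine ⟨fun ⟨m, M', h', H⟩ => ?_, fun H => ⟨n, M, h, H⟩⟩
  obtain rfl : n = m := by have := h.length_eq.symm.trans h'.length_eq; omega
  rwa [h.unique h']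

theorem markovReachabilityProblem_iff {c : MatCode} {r : RatCode} {n : ℕ}
    {M : Matrix (Fin (n + 2)) (Fin (n + 2)) ℚ} {x : ℚ} (h : c.Denotes M) (hr : r.Denotes x)
    (hM : M ∈ Matrix.rowStochastic ℚ (Fin (n + 2))) (hx : 0 < x) :
    MarkovReachabilityProblem (c, r) ↔ MarkovReachabilityYes M x := by
  refine ⟨fun ⟨m, M', x', h', hr', _, _, H⟩ => ?_, fun H => ⟨n, M, x, h, hr, hM, hx, H⟩⟩
  obtain rfl : n = m := by have := h.length_eq.symm.trans h'.length_eq; omega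
  rwa [h.unique h', hr.unique hr']

theorem exactValueProblem_iff {c : MatCode} {cμ cw : VecCode} {cT cθ : RatCode} {n : ℕ}
    {C : MarkovChain n} {T θ : ℚ} (hM : c.Denotes C.M) (hμ : cμ.Denotes C.μ) (hw : cw.Denotes C.w)
    (hT : cT.Denotes T) (hθ : cθ.Denotes θ) :
    ExactValueProblem (c, cμ, cw, cT, cθ) ↔ C.val (T : ℝ) < ((θ : ℝ) : EReal) := by
  refine ⟨fun ⟨m, C', T', θ', hM', hμ', hw', hT', hθ', H⟩ => ?_,
    fun H => ⟨n, C, T, θ, hM, hμ, hw, hT, hθ, H⟩⟩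
  obtain rfl : n = m := hM.length_eq.symm.trans hM'.length_eq
  obtain rfl : C = C' := by
    cases C; cases C'
    simp only [MarkovChain.mk.injEq]
    exact ⟨hM.unique hM', hμ.unique hμ', hw.unique hw'⟩
  rwa [hT.unique hT', hθ.unique hθ']

/-! ### From Positivity to Markov reachability -/

/-- The block matrix `½ [A + B, A - B; A - B, A + B]`, which is conjugate to the block diagonal
matrix with blocks `A` and `B`. -/
def doubledMatrix {ι : Type*} (A B : Matrix ι ι ℚ) : Matrix (ι ⊕ ι) (ι ⊕ ι) ℚ :=
  Matrix.fromBlocks ((2⁻¹ : ℚ) • (A + B)) ((2⁻¹ : ℚ) • (A - B))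
    ((2⁻¹ : ℚ) • (A - B)) ((2⁻¹ : ℚ) • (A + B))

theorem doubledMatrix_mul {ι : Type*} [Fintype ι] (A B A' B' : Matrix ι ι ℚ) :
    doubledMatrix A B * doubledMatrix A' B' = doubledMatrix (A * A') (B * B') := by
  simp only [doubledMatrix, Matrix.fromBlocks_multiply, Matrix.smul_mul, Matrix.mul_smul,
    Matrix.add_mul, Matrix.mul_add, Matrix.sub_mul, Matrix.mul_sub]
  congr 1 <;> module

theorem doubledMatrix_pow_succ {ι : Type*} [Fintype ι] [DecidableEq ι] (A B : Matrix ι ι ℚ)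
    (t : ℕ) : doubledMatrix A B ^ (t + 1) = doubledMatrix (A ^ (t + 1)) (B ^ (t + 1)) := by
  induction t with
  | zero => simp
  | succ t ih => rw [pow_succ, ih, doubledMatrix_mul, ← pow_succ, ← pow_succ]

/-- The stochastic matrix whose rows are all uniform. -/
def uniformMatrix (n : ℕ) : Matrix (Fin n) (Fin n) ℚ := fun _ _ => (n : ℚ)⁻¹

/-- The uniform matrix is idempotent. -/
theorem uniformMatrix_pow_succ {n : ℕ} (hn : n ≠ 0) (t : ℕ) :
    uniformMatrix n ^ (t + 1) = uniformMatrix n := by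
  refine IsIdempotentElem.pow_succ_eq t ?_
  ext i j
  have : (n : ℚ) ≠ 0 := by exact_mod_cast hn
  simp [Matrix.mul_apply, uniformMatrix, this]

/-- The stochastic matrix attached to an integer matrix whose entries are bounded by `D`. -/
def positivityChain {n : ℕ} (D : ℕ) (M : Matrix (Fin n) (Fin n) ℤ) :
    Matrix (Fin (n + n)) (Fin (n + n)) ℚ :=
  Matrix.reindexRingEquiv ℚ finSumFinEquiv (doubledMatrix (uniformMatrix n)
    (((n : ℚ) * D)⁻¹ • (Int.castRingHom ℚ).mapMatrix M))

theorem positivityChain_pow_succ {n : ℕ} (hn : n ≠ 0) (D : ℕ) (M : Matrix (Fin n) (Fin n) ℤ)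
    (t : ℕ) (i j : Fin n) :
    (positivityChain D M ^ (t + 1)) (Fin.castAdd n i) (Fin.castAdd n j) =
      2⁻¹ * ((n : ℚ)⁻¹ + (((n : ℚ) * D)⁻¹) ^ (t + 1) * ((M ^ (t + 1)) i j : ℤ)) := by
  rw [positivityChain, ← map_pow, doubledMatrix_pow_succ, uniformMatrix_pow_succ hn, smul_pow,
    ← map_pow]
  simp [doubledMatrix, uniformMatrix]
  ring

theorem positivityChain_eq_append {n D : ℕ} (hn : n ≠ 0) (hD : D ≠ 0)
    (M : Matrix (Fin n) (Fin n) ℤ) :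
    positivityChain D M = Fin.append
      (fun i => Fin.append (fun j => (((D : ℤ) + M i j : ℤ) : ℚ) / (2 * n * D : ℕ))
        (fun j => (((D : ℤ) - M i j : ℤ) : ℚ) / (2 * n * D : ℕ)))
      (fun i => Fin.append (fun j => (((D : ℤ) - M i j : ℤ) : ℚ) / (2 * n * D : ℕ))
        (fun j => (((D : ℤ) + M i j : ℤ) : ℚ) / (2 * n * D : ℕ))) := by
  have h1 : (n : ℚ) ≠ 0 := by exact_mod_cast hn
  have h2 : (D : ℚ) ≠ 0 := by exact_mod_cast hD
  funext i j
  refine Fin.addCases (fun i => ?_) (fun i => ?_) i <;>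
    refine Fin.addCases (fun j => ?_) (fun j => ?_) j <;>
    simp [positivityChain, doubledMatrix, uniformMatrix, -Fin.natAdd_eq_addNat] <;> field_simp

theorem positivityChain_mem_rowStochastic {n D : ℕ} (hn : n ≠ 0) (hD : D ≠ 0)
    {M : Matrix (Fin n) (Fin n) ℤ} (hM : ∀ i j, |M i j| ≤ D) :
    positivityChain D M ∈ Matrix.rowStochastic ℚ (Fin (n + n)) := by
  have h1 : (n : ℚ) ≠ 0 := by exact_mod_cast hn
  have h2 : (D : ℚ) ≠ 0 := by exact_mod_cast hD
  have hadd : ∀ i j, 0 ≤ (((D : ℤ) + M i j : ℤ) : ℚ) / (2 * n * D : ℕ) := fun i j =>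
    div_nonneg (by exact_mod_cast (by linarith [(abs_le.1 (hM i j)).1])) (by positivity)
  have hsub : ∀ i j, 0 ≤ (((D : ℤ) - M i j : ℤ) : ℚ) / (2 * n * D : ℕ) := fun i j =>
    div_nonneg (by exact_mod_cast (by linarith [(abs_le.1 (hM i j)).2])) (by positivity)
  have hsum : ∀ i, ∑ j, (((D : ℤ) + M i j : ℤ) : ℚ) / (2 * n * D : ℕ) +
      ∑ j, (((D : ℤ) - M i j : ℤ) : ℚ) / (2 * n * D : ℕ) = 1 := by
    intro i
    rw [← Finset.sum_add_distrib]
    have : ∀ j, (((D : ℤ) + M i j : ℤ) : ℚ) / (2 * n * D : ℕ) +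
        (((D : ℤ) - M i j : ℤ) : ℚ) / (2 * n * D : ℕ) = (n : ℚ)⁻¹ := fun j => by
      push_cast; field_simp; ring
    simp only [this]; simp [h1]
  rw [Matrix.mem_rowStochastic_iff_sum, positivityChain_eq_append hn hD]
  constructor
  · intro i j
    refine Fin.addCases (fun i => ?_) (fun i => ?_) i <;>
      refine Fin.addCases (fun j => ?_) (fun j => ?_) j
    · simpa only [Fin.append_left, Fin.append_right] using hadd i j
    · simpa only [Fin.append_left, Fin.append_right] using hsub i j
    · simpa only [Fin.append_left, Fin.append_right] using hsub i j
    · simpa only [Fin.append_left, Fin.append_right] using hadd i j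
  · intro i
    refine Fin.addCases (fun i => ?_) (fun i => ?_) i
    · simpa only [Fin.sum_univ_add, Fin.append_left, Fin.append_right] using hsum i
    · rw [Fin.sum_univ_add, add_comm]
      simpa only [Fin.append_left, Fin.append_right] using hsum i

/-- The code is that of a square integer matrix of dimension at least `2`. -/
abbrev IntMatCode.IsValid (c : IntMatCode) : Prop := 2 ≤ c.length ∧ ∀ r ∈ c, r.length = c.length

/-- A positive bound for the absolute values of the entries. -/
def IntMatCode.bound (c : IntMatCode) : ℕ := (c.flatten.map Int.natAbs).sum + 1

/-- The reduction from Positivity to Markov reachability on valid codes. -/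
def IntMatCode.toMarkov (c : IntMatCode) : MatCode × RatCode :=
  let D := c.bound
  let q := 2 * c.length * D
  let pos (r : List ℤ) : VecCode := r.map fun x => ((D : ℤ) + x, q)
  let neg (r : List ℤ) : VecCode := r.map fun x => ((D : ℤ) - x, q)
  (c.map (fun r => pos r ++ neg r) ++ c.map (fun r => neg r ++ pos r), (1, 2 * c.length))

theorem IntMatCode.primrec_isValid : PrimrecPred IntMatCode.IsValid :=
  (Primrec.nat_le.comp (.const 2) Primrec.list_length).and
    ((PrimrecRel.forall_mem_list (R := fun (r : List ℤ) (n : ℕ) => r.length = n)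
      (Primrec.eq.comp (Primrec.list_length.comp .fst) .snd)).comp .id Primrec.list_length)

theorem IntMatCode.primrec_bound : Primrec IntMatCode.bound :=
  Primrec.succ.comp (Primrec.list_foldr (g := fun _ => 0)
    (h := fun _ p => p.1 + p.2)
    (Primrec.list_map Primrec.list_flatten (Primrec.int_natAbs.comp .snd)) (.const 0)
    (Primrec.nat_add.comp (Primrec.fst.comp .snd) (Primrec.snd.comp .snd)))

theorem IntMatCode.primrec_toMarkov : Primrec IntMatCode.toMarkov := by
  have hq : Primrec fun c : IntMatCode => 2 * c.length * c.bound :=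
    Primrec.nat_mul.comp (Primrec.nat_mul.comp (.const 2) Primrec.list_length) primrec_bound
  have hpos : Primrec₂ fun (c : IntMatCode) (r : List ℤ) =>
      r.map fun x => ((c.bound : ℤ) + x, 2 * c.length * c.bound) :=
    Primrec.list_map .snd (Primrec.pair
      (Primrec.int_add.comp (Primrec.int_ofNat.comp (primrec_bound.comp (Primrec.fst.comp .fst)))
        .snd) (hq.comp (Primrec.fst.comp .fst)))
  have hneg : Primrec₂ fun (c : IntMatCode) (r : List ℤ) =>
      r.map fun x => ((c.bound : ℤ) - x, 2 * c.length * c.bound) :=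
    Primrec.list_map .snd (Primrec.pair
      (Primrec.int_sub.comp (Primrec.int_ofNat.comp (primrec_bound.comp (Primrec.fst.comp .fst)))
        .snd) (hq.comp (Primrec.fst.comp .fst)))
  exact Primrec.pair (Primrec.list_append.comp
      (Primrec.list_map .id (Primrec.list_append.comp₂ hpos hneg))
      (Primrec.list_map .id (Primrec.list_append.comp₂ hneg hpos)))
    (Primrec.pair (.const 1) (Primrec.nat_mul.comp (.const 2) Primrec.list_length))

theorem List.Forall₂.append_ofFn {α β : Type*} {R : α → β → Prop} {n m : ℕ} {l l' : List α}
    {v : Fin n → β} {v' : Fin m → β} (h : List.Forall₂ R l (List.ofFn v))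
    (h' : List.Forall₂ R l' (List.ofFn v')) :
    List.Forall₂ R (l ++ l') (List.ofFn (Fin.append v v')) := by
  rw [List.ofFn_fin_append]
  exact List.rel_append h h'

theorem IntMatCode.abs_le_bound {c : IntMatCode} {n : ℕ} {M : Matrix (Fin n) (Fin n) ℤ}
    (h : c.Denotes M) (i j : Fin n) : |M i j| ≤ c.bound := by
  rw [Int.abs_eq_natAbs, Nat.cast_le, IntMatCode.bound]
  refine Nat.le_succ_of_le (List.le_sum_of_mem (List.mem_map_of_mem ?_))
  rw [List.mem_flatten, h]
  exact ⟨_, (List.mem_ofFn' _ _).2 ⟨i, rfl⟩, (List.mem_ofFn' _ _).2 ⟨j, rfl⟩⟩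

theorem IntMatCode.toMarkov_denotes {c : IntMatCode} {n : ℕ} {M : Matrix (Fin n) (Fin n) ℤ}
    (h : c.Denotes M) (hn : n ≠ 0) : c.toMarkov.1.Denotes (positivityChain c.bound M) := by
  have hl := h.length_eq
  have hD : c.bound ≠ 0 := Nat.succ_ne_zero _
  rw [MatCode.denotes_iff, positivityChain_eq_append hn hD]
  have hq : 0 < 2 * n * c.bound := by positivity
  have key : ∀ (f : ℤ → ℤ) (r : List ℤ) (i : Fin n), r = List.ofFn (M i) →
      VecCode.Denotes (r.map fun x => (f x, 2 * c.length * c.bound))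
        (fun j => ((f (M i j) : ℤ) : ℚ) / (2 * n * c.bound : ℕ)) := by
    rintro f r i rfl
    refine List.forall₂_ofFn_right_iff.2 ⟨by simp, fun j => ?_⟩
    simp only [hl, List.getElem_map, List.getElem_ofFn]
    exact ⟨hq, rfl⟩
  exact List.Forall₂.append_ofFn
    (List.Forall₂.map_ofFn (IntMatCode.denotes_iff.1 h) fun r i hr =>
      List.Forall₂.append_ofFn (key _ r i hr) (key _ r i hr))
    (List.Forall₂.map_ofFn (IntMatCode.denotes_iff.1 h) fun r i hr =>
      List.Forall₂.append_ofFn (key _ r i hr) (key _ r i hr))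

theorem IntMatCode.isValid_iff {c : IntMatCode} :
    c.IsValid ↔ ∃ (n : ℕ) (M : Matrix (Fin (n + 2)) (Fin (n + 2)) ℤ), c.Denotes M := by
  simp only [IntMatCode.denotes_iff]
  constructor
  · rintro ⟨h2, H⟩
    obtain ⟨n, hn⟩ := Nat.exists_eq_add_of_le' h2
    refine ⟨n, List.exists_forall₂_ofFn_iff.2 ⟨hn, fun r hr => ?_⟩⟩
    have := (H r hr).trans hn
    exact ⟨fun i => r[i], List.ext_getElem (by simpa using this) fun i h1 h2 => by
      simp only [List.getElem_ofFn, Fin.getElem_fin]⟩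
  · rintro ⟨n, M, h⟩
    have hl := h.length_eq_ofFn
    refine ⟨by omega, fun r hr => ?_⟩
    obtain ⟨i, rfl⟩ := h.of_mem_ofFn hr
    simp [hl]

/-- Entry `(1, 2)` of powers of the chain exceeds `1 / (2 N)` by a positive multiple of the entry
of the powers of `M`. -/
theorem positivityYes_iff {n D : ℕ} (hD : D ≠ 0) (M : Matrix (Fin (n + 2)) (Fin (n + 2)) ℤ) :
    PositivityYes M ↔ MarkovReachabilityYes (n := n + 2 + n) (positivityChain D M)
      (1 / (2 * (n + 2) : ℕ)) := by
  refine exists_congr fun t => and_congr_right fun ht => ?_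
  obtain ⟨t, rfl⟩ := Nat.exists_eq_add_of_le' ht
  have h := positivityChain_pow_succ (Nat.succ_ne_zero (n + 1)) D M t 0 1
  have h0 : (0 : Fin (n + 2 + n + 2)) = Fin.castAdd (n + 2) (0 : Fin (n + 2)) := rfl
  have h1 : (1 : Fin (n + 2 + n + 2)) = Fin.castAdd (n + 2) (1 : Fin (n + 2)) := rfl
  have hpos : (0 : ℚ) < (((n + 2 : ℕ) : ℚ) * D)⁻¹ ^ (t + 1) := by
    have : (0 : ℚ) < D := by exact_mod_cast Nat.pos_of_ne_zero hD
    positivity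
  rw [h0, h1]
  refine Iff.trans ?_ (Iff.of_eq (congrArg (_ < ·) h.symm))
  have h3 : (1 : ℚ) / (2 * (n + 2) : ℕ) = 2⁻¹ * (((n + 2 : ℕ) : ℚ)⁻¹) := by
    push_cast; field_simp
  rw [h3, mul_lt_mul_iff_right₀ (by norm_num), lt_add_iff_pos_right, mul_pos_iff_of_pos_left hpos]
  exact_mod_cast Iff.rfl

theorem positivity_reduces_to_markovReachability :
    PositivityProblem ≤₀ MarkovReachabilityProblem := by
  refine ⟨fun c => if c.IsValid then c.toMarkov else ([], (0, 0)),
    (Primrec.ite IntMatCode.primrec_isValid IntMatCode.primrec_toMarkov (.const _)).to_comp,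
    fun c => ?_⟩
  dsimp only
  split_ifs with hc
  · obtain ⟨n, M, hM⟩ := IntMatCode.isValid_iff.1 hc
    have hl := hM.length_eq
    have hD : c.bound ≠ 0 := Nat.succ_ne_zero _
    rw [positivityProblem_iff hM, positivityYes_iff hD]
    refine (markovReachabilityProblem_iff (n := n + 2 + n)
      (IntMatCode.toMarkov_denotes hM (Nat.succ_ne_zero _)) ⟨?_, ?_⟩
      (positivityChain_mem_rowStochastic (Nat.succ_ne_zero _) hD (IntMatCode.abs_le_bound hM))
      ?_).symm
    · simp [hl]
    · simp [hl]
    · positivity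
  · constructor
    · rintro ⟨n, M, hM, -⟩
      exact (hc (IntMatCode.isValid_iff.2 ⟨n, M, hM⟩)).elim
    · rintro ⟨n, M, r, -, hr, -⟩
      exact (lt_irrefl _ hr.1).elim

/-! ### The optimal value as a lower convex envelope -/

namespace StoppingDistribution

/-- The distribution with mass `q` at `t₂` and mass `1 - q` at `t₁`. -/
noncomputable def twoPoint (t₁ t₂ : ℕ) (q : ℝ) (h0 : 0 ≤ q) (h1 : q ≤ 1) :
    StoppingDistribution where
  prob t := (if t = t₁ then 1 - q else 0) + if t = t₂ then q else 0
  nonneg t := by split_ifs <;> linarith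
  hasSum_one := by
    simpa using (hasSum_ite_eq t₁ (1 - q)).add (hasSum_ite_eq t₂ q)

theorem hasSum_twoPoint (t₁ t₂ : ℕ) {q : ℝ} (h0 : 0 ≤ q) (h1 : q ≤ 1) (f : ℕ → ℝ) :
    HasSum (fun t => f t * (twoPoint t₁ t₂ q h0 h1).prob t) (f t₁ * (1 - q) + f t₂ * q) := by
  convert (hasSum_ite_eq t₁ (f t₁ * (1 - q))).add (hasSum_ite_eq t₂ (f t₂ * q)) using 2 with t
  simp only [twoPoint, mul_add, mul_ite, mul_zero]
  congr 1 <;> split_ifs with h <;> simp [h]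

end StoppingDistribution

namespace MarkovChain

variable {n : ℕ} (C : MarkovChain n)

/-- Utilities grow at most linearly, so that expected utilities converge absolutely. -/
theorem abs_utility_le (t : ℕ) : |C.utility t| ≤ (t + 1) * ∑ j, |C.w j| := by
  have key : ∀ i, |Matrix.vecMul C.μ (C.M ^ i) ⬝ᵥ C.w| ≤ ∑ j, |C.w j| := by
    intro i
    refine (Finset.abs_sum_le_sum_abs _ _).trans (Finset.sum_le_sum fun j _ => ?_)
    have hi := pow_mem C.stochastic i
    have h0 : 0 ≤ Matrix.vecMul C.μ (C.M ^ i) j :=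
      Finset.sum_nonneg fun k _ => mul_nonneg (C.μ_nonneg k)
        (Matrix.nonneg_of_mem_rowStochastic hi)
    have h1 : Matrix.vecMul C.μ (C.M ^ i) j ≤ 1 := by
      rw [← C.μ_sum]
      exact Finset.sum_le_sum fun k _ => mul_le_of_le_one_right (C.μ_nonneg k)
        (Matrix.le_one_of_mem_rowStochastic hi)
    rw [abs_mul, abs_of_nonneg h0]
    exact mul_le_of_le_one_left (abs_nonneg _) h1
  refine (Finset.abs_sum_le_sum_abs _ _).trans ((Finset.sum_le_sum fun i _ => key i).trans ?_)
  simp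

theorem summable_utility_mul (δ : StoppingDistribution) {T : ℝ} (hδ : δ.HasExpectedTime T) :
    Summable fun t => (C.utility t : ℝ) * δ.prob t := by
  refine Summable.of_norm_bounded
    ((hδ.summable.add δ.hasSum_one.summable).mul_right ((∑ j, |C.w j| : ℚ) : ℝ)) fun t => ?_
  have h : |(C.utility t : ℝ)| ≤ (t + 1) * ((∑ j, |C.w j| : ℚ) : ℝ) := by
    exact_mod_cast C.abs_utility_le t
  rw [Real.norm_eq_abs, abs_mul, abs_of_nonneg (δ.nonneg t)]
  calc |(C.utility t : ℝ)| * δ.prob t ≤ (t + 1) * ((∑ j, |C.w j| : ℚ) : ℝ) * δ.prob t :=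
        mul_le_mul_of_nonneg_right h (δ.nonneg t)
    _ = _ := by ring

theorem val_of_neg {T : ℝ} (hT : T < 0) : C.val T = ⊤ := by
  simp only [val, iInf_eq_top]
  intro δ hδ
  exact absurd (hδ.nonneg fun t => mul_nonneg t.cast_nonneg (δ.nonneg t)) hT.not_ge

/-- If the value at `T` is less than `θ`, then no line through `(T, θ)` is below all utilities. -/
theorem exists_utility_lt_of_val_lt {T θ : ℝ} (h : C.val T < (θ : EReal)) (l : ℝ) :
    ∃ t : ℕ, (C.utility t : ℝ) < θ + l * (t - T) := by
  simp only [val, iInf_lt_iff] at h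
  obtain ⟨δ, hδ, h⟩ := h
  rw [EReal.coe_lt_coe_iff] at h
  by_contra! hc
  refine h.not_ge ?_
  have h1 : HasSum (fun t : ℕ => (θ + l * (t - T)) * δ.prob t) θ := by
    have h2 := (δ.hasSum_one.mul_left (θ - l * T)).add (HasSum.mul_left l hδ)
    rw [show (θ - l * T) * 1 + l * T = θ by ring] at h2
    exact h2.congr_fun fun t => by ring
  exact hasSum_le (fun t => mul_le_mul_of_nonneg_right (hc t) (δ.nonneg t)) h1
    (C.summable_utility_mul δ hδ).hasSum

/-- The value at `T` is at most the interpolation of two utilities. -/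
theorem val_le_of_le_of_le {T : ℝ} {t₁ t₂ : ℕ} (h : t₁ < t₂) (h1 : t₁ ≤ T) (h2 : T ≤ t₂) :
    C.val T ≤ ((C.utility t₁ * (1 - (T - t₁) / (t₂ - t₁)) +
      C.utility t₂ * ((T - t₁) / (t₂ - t₁)) : ℝ) : EReal) := by
  have hpos : (0 : ℝ) < t₂ - t₁ := by have : (t₁ : ℝ) < t₂ := by exact_mod_cast h
                                      linarith
  have hq0 : 0 ≤ (T - t₁) / (t₂ - t₁) := div_nonneg (by linarith) hpos.le
  have hq1 : (T - t₁) / (t₂ - t₁) ≤ 1 := (div_le_one hpos).2 (by linarith)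
  have hs := StoppingDistribution.hasSum_twoPoint t₁ t₂ hq0 hq1
  have hT : (StoppingDistribution.twoPoint t₁ t₂ _ hq0 hq1).HasExpectedTime T := by
    have h3 := hs fun t => (t : ℝ)
    rwa [show (t₁ : ℝ) * (1 - (T - t₁) / (t₂ - t₁)) + t₂ * ((T - t₁) / (t₂ - t₁)) = T by
      field_simp; ring] at h3
  refine (iInf₂_le (StoppingDistribution.twoPoint t₁ t₂ _ hq0 hq1) hT).trans ?_
  rw [EReal.coe_le_coe_iff]
  exact (hs fun t => (C.utility t : ℝ)).tsum_eq.le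

/-- With expected stopping time `0`, one has to stop at once. -/
theorem val_zero_lt_iff {θ : ℚ} : C.val 0 < ((θ : ℝ) : EReal) ↔ C.utility 0 < θ := by
  constructor
  · intro h
    by_contra! h0
    -- a line through `(0, θ)` that is steep enough to be below all utilities
    obtain ⟨t, ht⟩ := C.exists_utility_lt_of_val_lt h (-((|θ| + 2 * ∑ j, |C.w j| : ℚ) : ℝ))
    have ht' : C.utility t < θ - (|θ| + 2 * ∑ j, |C.w j|) * t := by
      have : (C.utility t : ℝ) < ((θ - (|θ| + 2 * ∑ j, |C.w j|) * t : ℚ) : ℝ) := by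
        refine ht.trans_eq ?_
        push_cast; ring
      exact_mod_cast this
    rcases Nat.eq_zero_or_pos t with rfl | hpos
    · simp at ht'; linarith
    · have h1 : (1 : ℚ) ≤ t := by exact_mod_cast hpos
      have hW : 0 ≤ ∑ j, |C.w j| := Finset.sum_nonneg fun _ _ => abs_nonneg _
      have h2 := (abs_le.1 (C.abs_utility_le t)).1
      have h3 := le_abs_self θ
      nlinarith [mul_le_mul_of_nonneg_left h1 (abs_nonneg θ), mul_le_mul_of_nonneg_left h1 hW]
  · intro h
    refine (C.val_le_of_le_of_le (t₁ := 0) (t₂ := 1) one_pos (by simp) (by simp)).trans_lt ?_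
    simpa using h

/-- Suppose that a line through `(T, θ)` is below the utilities before time `T`, and touches one of
them. Then the value at `T` is less than `θ` exactly if some utility is below the line. -/
theorem val_lt_iff {T θ l : ℚ} (hl : ∀ k : ℕ, (k : ℚ) < T → θ + l * (k - T) ≤ C.utility k)
    (hk : ∃ k : ℕ, (k : ℚ) < T ∧ C.utility k = θ + l * (k - T)) :
    C.val (T : ℝ) < ((θ : ℝ) : EReal) ↔ ∃ t : ℕ, C.utility t < θ + l * (t - T) := by
  constructor
  · intro h
    obtain ⟨t, ht⟩ := C.exists_utility_lt_of_val_lt h l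
    exact ⟨t, by exact_mod_cast ht⟩
  · rintro ⟨t, ht⟩
    obtain ⟨k, hkT, hk⟩ := hk
    have hTt : T ≤ t := not_lt.1 fun h => (hl t h).not_gt ht
    have hkt : k < t := by exact_mod_cast hkT.trans_le hTt
    refine (C.val_le_of_le_of_le hkt (T := T) (by exact_mod_cast hkT.le)
      (by exact_mod_cast hTt)).trans_lt ?_
    rw [EReal.coe_lt_coe_iff]
    have hpos : (0 : ℚ) < t - k := by linarith
    have hq : (0 : ℚ) < (T - k) / (t - k) := div_pos (by linarith) hpos
    have key : C.utility k * (1 - (T - k) / (t - k)) + C.utility t * ((T - k) / (t - k)) < θ := by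
      have h1 := mul_lt_mul_of_pos_right ht hq
      have h2 : (θ + l * (k - T)) * (1 - (T - k) / (t - k)) +
          (θ + l * (t - T)) * ((T - k) / (t - k)) = θ := by
        field_simp
        ring
      rw [hk]
      linarith
    exact_mod_cast key

end MarkovChain

/-! ### From Markov reachability to the exact value problem -/

open Matrix in
/-- The matrix `M` extended by two vertices in front: from the first vertex one moves to the
second, and from there as from the first vertex of `M`. -/
def delayedMatrix {n : ℕ} (M : Matrix (Fin (n + 1)) (Fin (n + 1)) ℚ) :
    Matrix (Fin (n + 1 + 1 + 1)) (Fin (n + 1 + 1 + 1)) ℚ :=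
  vecCons (vecCons 0 (vecCons 1 fun _ => 0))
    (vecCons (vecCons 0 (vecCons 0 (M 0))) fun i => vecCons 0 (vecCons 0 (M i)))

open Matrix in
theorem vecMul_delayedMatrix {n : ℕ} (M : Matrix (Fin (n + 1)) (Fin (n + 1)) ℚ) (a b : ℚ)
    (x : Fin (n + 1) → ℚ) :
    vecMul (vecCons a (vecCons b x)) (delayedMatrix M) =
      vecCons 0 (vecCons a (b • M 0 + vecMul x M)) := by
  funext j
  refine Fin.cases ?_ (fun j => Fin.cases ?_ (fun j => ?_) j) j <;>
    simp [delayedMatrix, vecMul, dotProduct, Fin.sum_univ_succ (n := n + 1 + 1),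
      Fin.sum_univ_succ (n := n + 1)]

theorem delayedMatrix_mem_rowStochastic {n : ℕ} {M : Matrix (Fin (n + 1)) (Fin (n + 1)) ℚ}
    (hM : M ∈ Matrix.rowStochastic ℚ (Fin (n + 1))) :
    delayedMatrix M ∈ Matrix.rowStochastic ℚ (Fin (n + 1 + 1 + 1)) := by
  have h0 : ∀ i j, 0 ≤ M i j := fun i j => Matrix.nonneg_of_mem_rowStochastic hM
  have h1 : ∀ i, ∑ j, M i j = 1 := Matrix.sum_row_of_mem_rowStochastic hM
  rw [Matrix.mem_rowStochastic_iff_sum]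
  constructor
  · intro i j
    refine Fin.cases ?_ (fun i => Fin.cases ?_ (fun i => ?_) i) i <;>
      refine Fin.cases ?_ (fun j => Fin.cases ?_ (fun j => ?_) j) j <;>
      simp [delayedMatrix, h0]
  · intro i
    refine Fin.cases ?_ (fun i => Fin.cases ?_ (fun i => ?_) i) i <;>
      simp [delayedMatrix, Fin.sum_univ_succ (n := n + 1 + 1), Fin.sum_univ_succ (n := n + 1), h1]

open Matrix in
/-- The second unit vector. -/
def unitVecOne (n : ℕ) : Fin (n + 2) → ℚ := vecCons 0 (vecCons 1 fun _ => 0)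

theorem dotProduct_unitVecOne {n : ℕ} (v : Fin (n + 2) → ℚ) : v ⬝ᵥ unitVecOne n = v 1 := by
  simp [dotProduct, unitVecOne, Fin.sum_univ_succ]

open Matrix in
/-- A Markov chain whose utility is `0` at time `0` and `r - (M ^ t)₁₂` at times `t ≥ 1`. -/
def reachabilityChain {n : ℕ} (M : Matrix (Fin (n + 2)) (Fin (n + 2)) ℚ) (r : ℚ)
    (hM : M ∈ Matrix.rowStochastic ℚ (Fin (n + 2))) : MarkovChain (n + 2 + 1 + 1) where
  M := delayedMatrix M
  μ := vecCons 1 (vecCons 0 fun _ => 0)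
  w := vecCons 0 (vecCons (r - M 0 ⬝ᵥ unitVecOne n) (unitVecOne n - M *ᵥ unitVecOne n))
  stochastic := delayedMatrix_mem_rowStochastic hM
  μ_nonneg i := by refine Fin.cases ?_ (fun i => Fin.cases ?_ (fun i => ?_) i) i <;> simp
  μ_sum := by simp [Fin.sum_univ_succ (n := n + 2 + 1), Fin.sum_univ_succ (n := n + 2)]

section
variable {n : ℕ} {M : Matrix (Fin (n + 2)) (Fin (n + 2)) ℚ} {r : ℚ}
  (hM : M ∈ Matrix.rowStochastic ℚ (Fin (n + 2)))

open Matrix in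
/-- From time `2` on, the chain is distributed like `M` started at its first vertex, one step
behind. -/
theorem reachabilityChain_vecMul_pow (t : ℕ) :
    vecMul (reachabilityChain M r hM).μ ((reachabilityChain M r hM).M ^ (t + 2)) =
      vecCons 0 (vecCons 0 ((M ^ (t + 1)) 0)) := by
  induction t with
  | zero =>
    have h0 : vecMul (fun _ : Fin (n + 1 + 1) => (0 : ℚ)) M = 0 := Matrix.zero_vecMul M
    simp only [reachabilityChain, pow_succ, pow_zero, one_mul, ← vecMul_vecMul,
      vecMul_delayedMatrix, h0]
    simp
  | succ t ih =>
    rw [pow_succ, ← vecMul_vecMul, ih, pow_succ M (t + 1), Matrix.mul_apply_eq_vecMul]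
    refine (vecMul_delayedMatrix M _ _ _).trans ?_
    simp

theorem reachabilityChain_utility_zero : (reachabilityChain M r hM).utility 0 = 0 := by
  simp [MarkovChain.utility, reachabilityChain]

open Matrix in
/-- The rewards `(I - M) e` telescope. -/
theorem reachabilityChain_utility_succ (t : ℕ) :
    (reachabilityChain M r hM).utility (t + 1) = r - (M ^ (t + 1)) 0 1 := by
  induction t with
  | zero =>
    have h0 : vecMul (fun _ : Fin (n + 1 + 1) => (0 : ℚ)) M = 0 := Matrix.zero_vecMul M
    rw [MarkovChain.utility, Finset.sum_range_succ, ← MarkovChain.utility,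
      reachabilityChain_utility_zero]
    simp only [reachabilityChain, zero_add, pow_one]
    refine (congrArg (· ⬝ᵥ _) (vecMul_delayedMatrix M _ _ _)).trans ?_
    simp [h0, dotProduct_unitVecOne]
  | succ t ih =>
    rw [MarkovChain.utility, Finset.sum_range_succ, ← MarkovChain.utility, ih,
      reachabilityChain_vecMul_pow]
    have h : (M ^ (t + 1)) 0 ⬝ᵥ (M *ᵥ unitVecOne n) = (M ^ (t + 1 + 1)) 0 1 := by
      rw [dotProduct_mulVec, ← Matrix.mul_apply_eq_vecMul, ← pow_succ, dotProduct_unitVecOne]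
    simp [reachabilityChain, dotProduct_sub, dotProduct_unitVecOne, h]

theorem markovReachabilityYes_iff :
    MarkovReachabilityYes M r ↔
      (reachabilityChain M r hM).val ((1 : ℚ) : ℝ) < (((0 : ℚ) : ℝ) : EReal) := by
  have h0 := reachabilityChain_utility_zero (r := r) hM
  rw [MarkovChain.val_lt_iff (l := 0)]
  · constructor
    · rintro ⟨t, ht, H⟩
      obtain ⟨t, rfl⟩ := Nat.exists_eq_add_of_le' ht
      exact ⟨t + 1, by rw [reachabilityChain_utility_succ]; linarith⟩
    · rintro ⟨t, H⟩
      cases t with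
      | zero => rw [h0] at H; norm_num at H
      | succ t =>
        rw [reachabilityChain_utility_succ] at H
        exact ⟨t + 1, by omega, by linarith⟩
  · intro k hk
    obtain rfl : k = 0 := by
      have : k < 1 := by exact_mod_cast hk
      omega
    simp [h0]
  · exact ⟨0, by norm_num, by simp [h0]⟩

end

/-- A code of the second unit vector, of the same length as `c`. -/
def MatCode.unitVecOne (c : MatCode) : VecCode :=
  RatCode.ofInt 0 :: RatCode.ofInt 1 :: c.tail.tail.map fun _ => RatCode.ofInt 0

/-- The reduction from Markov reachability to the exact value problem on valid codes. -/
def MatCode.toExactValue (c : MatCode) (r : RatCode) : ExactValueCode :=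
  let z := RatCode.ofInt 0
  let e := c.unitVecOne
  ((z :: RatCode.ofInt 1 :: c.map fun _ => z) :: (z :: z :: c.headI) :: c.map fun l => z :: z :: l,
    RatCode.ofInt 1 :: z :: c.map fun _ => z,
    z :: RatCode.sub r (VecCode.dot c.headI e) :: List.zipWith RatCode.sub e (c.mulVec e),
    RatCode.ofInt 1, z)

theorem MatCode.primrec_unitVecOne : Primrec MatCode.unitVecOne :=
  Primrec.list_cons.comp (.const _) (Primrec.list_cons.comp (.const _)
    (Primrec.list_map (Primrec.list_tail.comp Primrec.list_tail) (Primrec.const _).to₂))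

theorem MatCode.primrec_toExactValue : Primrec₂ MatCode.toExactValue := by
  have hc : Primrec fun p : MatCode × RatCode => p.1 := .fst
  have he := MatCode.primrec_unitVecOne.comp hc
  have hz : Primrec fun p : MatCode × RatCode => p.1.map fun _ => RatCode.ofInt 0 :=
    Primrec.list_map hc (Primrec.const _).to₂
  refine Primrec.pair (Primrec.list_cons.comp
    (Primrec.list_cons.comp (.const _) (Primrec.list_cons.comp (.const _) hz))
    (Primrec.list_cons.comp (Primrec.list_cons.comp (.const _) (Primrec.list_cons.comp (.const _)
      (Primrec.list_headI.comp hc)))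
      (Primrec.list_map hc (Primrec.list_cons.comp (.const _)
        (Primrec.list_cons.comp (.const _) .snd)))))
    (Primrec.pair (Primrec.list_cons.comp (.const _) (Primrec.list_cons.comp (.const _) hz))
    (Primrec.pair (Primrec.list_cons.comp (.const _) (Primrec.list_cons.comp
      (RatCode.primrec_sub.comp .snd (VecCode.primrec_dot.comp (Primrec.list_headI.comp hc) he))
      ((Primrec.list_zipWith RatCode.primrec_sub).comp he (MatCode.primrec_mulVec.comp hc he))))
    (.const _)))

theorem MatCode.unitVecOne_denotes {c : MatCode} {n : ℕ} (h : c.length = n + 2) :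
    c.unitVecOne.Denotes (_root_.unitVecOne n) :=
  (VecCode.denotes_const_map RatCode.denotes_zero (by simp [h])).cons RatCode.denotes_one
    |>.cons RatCode.denotes_zero

theorem MatCode.Denotes.headI {c : MatCode} {n : ℕ} {M : Matrix (Fin (n + 1)) (Fin (n + 1)) ℚ}
    (h : c.Denotes M) : VecCode.Denotes c.headI (M 0) := by
  obtain ⟨hl, H⟩ := List.forall₂_ofFn_right_iff.1 (MatCode.denotes_iff.1 h)
  cases c with
  | nil => simp at hl
  | cons r c => exact H 0

theorem MatCode.Denotes.delayedMatrix {c : MatCode} {n : ℕ}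
    {M : Matrix (Fin (n + 1)) (Fin (n + 1)) ℚ} (h : c.Denotes M) :
    MatCode.Denotes ((RatCode.ofInt 0 :: RatCode.ofInt 1 :: c.map fun _ => RatCode.ofInt 0) ::
      (RatCode.ofInt 0 :: RatCode.ofInt 0 :: c.headI) ::
      c.map fun l => RatCode.ofInt 0 :: RatCode.ofInt 0 :: l) (delayedMatrix M) := by
  rw [MatCode.denotes_iff]
  refine List.Forall₂.cons_ofFn ?_ (List.Forall₂.cons_ofFn ?_ ?_)
  · exact (VecCode.denotes_const_map RatCode.denotes_zero h.length_eq).cons RatCode.denotes_one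
      |>.cons RatCode.denotes_zero
  · exact (h.headI.cons RatCode.denotes_zero).cons RatCode.denotes_zero
  · exact List.Forall₂.map_ofFn (MatCode.denotes_iff.1 h) fun r i hr =>
      (VecCode.Denotes.cons RatCode.denotes_zero hr).cons RatCode.denotes_zero

theorem markovReachability_reduces_to_exactValue :
    MarkovReachabilityProblem ≤₀ ExactValueProblem := by
  have hprim : PrimrecPred fun c : MatCode × RatCode =>
      (c.1.IsStochastic ∧ 2 ≤ c.1.length) ∧ 0 < c.2.2 ∧ 0 < c.2.1 :=
    ((MatCode.primrec_isStochastic.comp .fst).and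
      (Primrec.nat_le.comp (.const 2) (Primrec.list_length.comp .fst))).and
    ((Primrec.nat_lt.comp (.const 0) (Primrec.snd.comp .snd)).and
      (Primrec.int_lt.comp (.const 0) (Primrec.fst.comp .snd)))
  refine ⟨fun c => if (c.1.IsStochastic ∧ 2 ≤ c.1.length) ∧ 0 < c.2.2 ∧ 0 < c.2.1 then
      MatCode.toExactValue c.1 c.2 else ([], [], [], (0, 0), (0, 0)),
    (Primrec.ite hprim (MatCode.primrec_toExactValue.comp .fst .snd) (.const _)).to_comp, ?_⟩
  rintro ⟨c, r⟩
  dsimp only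
  split_ifs with hc
  · obtain ⟨⟨hst, h2⟩, hr, hr1⟩ := hc
    obtain ⟨n, hn⟩ := Nat.exists_eq_add_of_le' h2
    obtain ⟨M, hM⟩ := hst.exists_denotes hn
    obtain ⟨x, hx⟩ := RatCode.exists_denotes_iff.2 hr
    have hMs := hM.isStochastic_iff.1 hst
    rw [markovReachabilityProblem_iff hM hx hMs (hx.pos_iff.2 hr1), markovReachabilityYes_iff hMs]
    have he := MatCode.unitVecOne_denotes hn
    refine (exactValueProblem_iff hM.delayedMatrix ?_ ?_ RatCode.denotes_one
      RatCode.denotes_zero).symm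
    · exact (VecCode.denotes_const_map RatCode.denotes_zero hn).cons RatCode.denotes_zero
        |>.cons RatCode.denotes_one
    · exact ((he.sub (hM.mulVec he)).cons (hx.sub (hM.headI.dot he))).cons RatCode.denotes_zero
  · constructor
    · rintro ⟨n, M, x, hM, hx, hMs, hx0, -⟩
      exact (hc ⟨⟨hM.isStochastic_iff.2 hMs, by rw [MatCode.Denotes.length_eq hM]; omega⟩, hx.1,
        hx.pos_iff.1 hx0⟩).elim
    · rintro ⟨n, C, T, θ, -, -, -, hT, -⟩
      exact (lt_irrefl _ hT.1).elim

/-! ### From the exact value problem to Positivity -/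

open Matrix in
/-- The matrix of a linear recurrence that accumulates, in the third coordinate, `κ` and the
rewards `w` collected along the chain `M` started at `μ`; the second coordinate reads the sum
off. -/
def accumulatorMatrix {n : ℕ} (M : Matrix (Fin n) (Fin n) ℚ) (μ w : Fin n → ℚ) (κ : ℚ) :
    Matrix (Fin (n + 1 + 1 + 1)) (Fin (n + 1 + 1 + 1)) ℚ :=
  vecCons (vecCons 0 (vecCons 0 (vecCons κ μ)))
    (vecCons (vecCons 0 (vecCons 0 (vecCons 0 fun _ => 0)))
      (vecCons (vecCons 0 (vecCons 1 (vecCons 1 fun _ => 0)))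
        fun i => vecCons 0 (vecCons (w i) (vecCons (w i) (M i)))))

section
variable {n : ℕ} (M : Matrix (Fin n) (Fin n) ℚ) (μ w : Fin n → ℚ) (κ : ℚ)

open Matrix in
theorem vecMul_accumulatorMatrix (s b a : ℚ) (x : Fin n → ℚ) :
    vecMul (vecCons s (vecCons b (vecCons a x))) (accumulatorMatrix M μ w κ) =
      vecCons 0 (vecCons (a + x ⬝ᵥ w) (vecCons (s * κ + a + x ⬝ᵥ w) (s • μ + vecMul x M))) := by
  funext j
  refine Fin.cases ?_ (fun j => Fin.cases ?_ (fun j => Fin.cases ?_ (fun j => ?_) j) j) j <;>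
    simp [accumulatorMatrix, vecMul, dotProduct, Fin.sum_univ_succ (n := n + 1 + 1),
      Fin.sum_univ_succ (n := n + 1), Fin.sum_univ_succ (n := n), add_assoc]

open Matrix in
/-- The first row of a power: the accumulated sum, twice, and the distribution of the chain. -/
theorem accumulatorMatrix_pow_zero_row (t : ℕ) :
    (accumulatorMatrix M μ w κ ^ (t + 2)) 0 =
      vecCons 0 (vecCons (κ + ∑ i ∈ Finset.range (t + 1), vecMul μ (M ^ i) ⬝ᵥ w)
        (vecCons (κ + ∑ i ∈ Finset.range (t + 1), vecMul μ (M ^ i) ⬝ᵥ w)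
          (vecMul μ (M ^ (t + 1))))) := by
  induction t with
  | zero =>
    rw [pow_succ, zero_add, pow_one, Matrix.mul_apply_eq_vecMul]
    refine (vecMul_accumulatorMatrix M μ w κ 0 0 κ μ).trans ?_
    simp
  | succ t ih =>
    rw [pow_succ, Matrix.mul_apply_eq_vecMul, ih, vecMul_accumulatorMatrix,
      Finset.sum_range_succ _ (t + 1), vecMul_vecMul, ← pow_succ]
    simp [add_assoc]

end

theorem MarkovChain.sum_vecMul_pow {n : ℕ} (C : MarkovChain n) (i : ℕ) :
    ∑ j, Matrix.vecMul C.μ (C.M ^ i) j = 1 := by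
  have h := Matrix.one_vecMul_of_mem_rowStochastic (pow_mem C.stochastic i)
  rw [← C.μ_sum, ← dotProduct_one, ← dotProduct_one, ← Matrix.dotProduct_mulVec, h]

/-- The recurrence for the difference of the line through `(T, θ)` of slope `l` and the
utilities. -/
def MarkovChain.differenceMatrix {n : ℕ} (C : MarkovChain n) (T θ l : ℚ) :
    Matrix (Fin (n + 1 + 1 + 1)) (Fin (n + 1 + 1 + 1)) ℚ :=
  accumulatorMatrix C.M C.μ ((fun _ => l) - C.w) (θ - l * T - l)

theorem MarkovChain.differenceMatrix_pow_apply {n : ℕ} (C : MarkovChain n) (T θ l : ℚ) (t : ℕ) :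
    (C.differenceMatrix T θ l ^ (t + 2)) 0 1 = θ + l * (t - T) - C.utility t := by
  have h : ∀ i, Matrix.vecMul C.μ (C.M ^ i) ⬝ᵥ ((fun _ => l) - C.w) =
      l - Matrix.vecMul C.μ (C.M ^ i) ⬝ᵥ C.w := fun i => by
    rw [dotProduct_sub]
    congr 1
    rw [dotProduct, ← Finset.sum_mul, C.sum_vecMul_pow, one_mul]
  rw [differenceMatrix, accumulatorMatrix_pow_zero_row]
  simp only [Matrix.cons_val_one, Matrix.cons_val_zero, h, Finset.sum_sub_distrib]
  simp [MarkovChain.utility]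
  ring

/-- The difference recurrence is an instance of Positivity, up to a common denominator. -/
theorem MarkovChain.exists_utility_lt_iff {n : ℕ} (C : MarkovChain n) (T θ l : ℚ) {d : ℕ}
    (hd : 0 < d) {N : Matrix (Fin (n + 1 + 1 + 1)) (Fin (n + 1 + 1 + 1)) ℤ}
    (hN : (Int.castRingHom ℚ).mapMatrix N = (d : ℚ) • C.differenceMatrix T θ l) :
    PositivityYes (n := n + 1) N ↔ ∃ t : ℕ, C.utility t < θ + l * (t - T) := by
  have key : ∀ t, 0 < (N ^ t) 0 1 ↔ 0 < (C.differenceMatrix T θ l ^ t) 0 1 := by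
    intro t
    have h : (((N ^ t) 0 1 : ℤ) : ℚ) = d ^ t * (C.differenceMatrix T θ l ^ t) 0 1 := by
      have := congrFun (congrFun (map_pow (Int.castRingHom ℚ).mapMatrix N t) 0) 1
      rw [hN, smul_pow] at this
      exact this
    have hd' : (0 : ℚ) < (d : ℚ) ^ t := pow_pos (by exact_mod_cast hd) t
    rw [← Int.cast_pos (R := ℚ), h, mul_pos_iff_of_pos_left hd']
  constructor
  · rintro ⟨t, ht, H⟩
    rw [key] at H
    obtain _ | _ | t := t
    · omega
    · rw [zero_add, pow_one] at H
      simp [differenceMatrix, accumulatorMatrix] at H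
    · rw [differenceMatrix_pow_apply] at H
      exact ⟨t, by linarith⟩
  · rintro ⟨t, H⟩
    refine ⟨t + 2, by omega, (key _).2 ?_⟩
    rw [differenceMatrix_pow_apply]
    linarith

/-! ### Clearing denominators -/

/-- The product of all denominators. -/
def MatCode.commonDenominator (c : MatCode) : ℕ := (c.flatten.map Prod.snd).prod

/-- The integer matrix obtained by multiplication with the common denominator. -/
def MatCode.clearDenominators (c : MatCode) : IntMatCode :=
  c.map fun r => r.map fun x => x.1 * ((c.commonDenominator / x.2 : ℕ) : ℤ)

theorem MatCode.primrec_commonDenominator : Primrec MatCode.commonDenominator :=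
  Primrec.list_foldr (g := fun _ => 1) (h := fun _ p => p.1 * p.2)
    (Primrec.list_map Primrec.list_flatten (Primrec.snd.comp .snd)) (.const 1)
    (Primrec.nat_mul.comp (Primrec.fst.comp .snd) (Primrec.snd.comp .snd))

theorem MatCode.primrec_clearDenominators : Primrec MatCode.clearDenominators :=
  Primrec.list_map .id (Primrec.list_map .snd (Primrec.int_mul.comp (Primrec.fst.comp .snd)
    (Primrec.int_ofNat.comp (Primrec.nat_div.comp
      (MatCode.primrec_commonDenominator.comp (Primrec.fst.comp .fst)) (Primrec.snd.comp .snd)))))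

theorem MatCode.Denotes.clearDenominators {c : MatCode} {n : ℕ} {M : Matrix (Fin n) (Fin n) ℚ}
    (h : c.Denotes M) : 0 < c.commonDenominator ∧ ∃ N : Matrix (Fin n) (Fin n) ℤ,
      c.clearDenominators.Denotes N ∧
      (Int.castRingHom ℚ).mapMatrix N = (c.commonDenominator : ℚ) • M := by
  have h' := MatCode.denotes_iff.1 h
  have hden : ∀ r ∈ c, ∀ x ∈ r, 0 < x.2 := fun r hr x hx => by
    obtain ⟨i, hi⟩ := h'.of_mem_ofFn hr
    exact hi.isValid.2 x hx
  refine ⟨List.prod_pos fun d hd => ?_, ?_⟩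
  · obtain ⟨x, hx, rfl⟩ := List.mem_map.1 hd
    obtain ⟨r, hr, hx⟩ := List.mem_flatten.1 hx
    exact hden r hr x hx
  have hx : ∀ r ∈ c, ∀ x ∈ r, ∀ y, RatCode.Denotes x y →
      ((x.1 * ((c.commonDenominator / x.2 : ℕ) : ℤ) : ℤ) : ℚ) = c.commonDenominator * y := by
    rintro r hr x hx y ⟨h0, rfl⟩
    have hdvd : x.2 ∣ c.commonDenominator :=
      List.dvd_prod (List.mem_map_of_mem (List.mem_flatten.2 ⟨r, hr, hx⟩))
    have h1 : (x.2 : ℚ) ≠ 0 := by exact_mod_cast h0.ne'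
    rw [Int.cast_mul, Int.cast_natCast, Nat.cast_div hdvd h1]
    ring
  obtain ⟨hl, H⟩ := List.forall₂_ofFn_right_iff.1 h'
  have H2 : ∀ i j, ∃ r ∈ c, ∃ x ∈ r, RatCode.Denotes x (M i j) := fun i j => by
    obtain ⟨hl', H'⟩ := List.forall₂_ofFn_right_iff.1 (H i)
    exact ⟨_, List.getElem_mem _, _, List.getElem_mem _, H' j⟩
  refine ⟨Matrix.of fun i j => ((c.commonDenominator : ℚ) * M i j).num, ?_, ?_⟩
  · refine IntMatCode.denotes_iff.2 (List.forall₂_ofFn_right_iff.2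
      ⟨by simpa [MatCode.clearDenominators] using hl, fun i => ?_⟩)
    obtain ⟨hl', H'⟩ := List.forall₂_ofFn_right_iff.1 (H i)
    refine List.ext_getElem (by simpa [MatCode.clearDenominators] using hl') fun j h1 h2 => ?_
    have hj : j < n := by simpa using h2
    have := hx _ (List.getElem_mem _) _ (List.getElem_mem _) _ (H' ⟨j, hj⟩)
    simp only [MatCode.clearDenominators, List.getElem_map, List.getElem_ofFn, Matrix.of_apply]
    rw [← this, Rat.num_intCast]
  · ext i j
    obtain ⟨r, hr, x, hxr, hxy⟩ := H2 i j
    have := hx r hr x hxr _ hxy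
    change ((((c.commonDenominator : ℚ) * M i j).num : ℤ) : ℚ) = c.commonDenominator * M i j
    rw [← this, Rat.num_intCast]

/-! ### The supporting line, on codes -/

namespace ExactValueCode

/-- The code of `∑ i ≤ k, M ^ i * w`. -/
def cumulativeReward (I : ExactValueCode) (k : ℕ) : VecCode :=
  Nat.rec I.2.2.1 (fun _ g => List.zipWith RatCode.add I.2.2.1 (MatCode.mulVec I.1 g)) k

/-- The code of the utility at time `k`. -/
def utility (I : ExactValueCode) (k : ℕ) : RatCode := VecCode.dot I.2.1 (I.cumulativeReward k)

/-- The code of the slope `(θ - u_k) / (T - k)` of the line through `(k, u_k)` and `(T, θ)`. -/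
def slope (I : ExactValueCode) (k : ℕ) : RatCode :=
  RatCode.div (RatCode.sub I.2.2.2.2 (I.utility k)) (RatCode.sub I.2.2.2.1 (RatCode.ofInt k))

/-- The code of the largest slope for the times `0`, …, `k` that precede `T`. -/
def maxSlope (I : ExactValueCode) (k : ℕ) : RatCode :=
  Nat.rec (I.slope 0) (fun j l =>
    if RatCode.Lt (RatCode.ofInt (j + 1 : ℕ)) I.2.2.2.1 then RatCode.sup l (I.slope (j + 1))
    else l) k

/-- The code of `MarkovChain.differenceMatrix` for the slope coded by `l`. -/
def differenceCode (I : ExactValueCode) (l : RatCode) : MatCode :=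
  let z := RatCode.ofInt 0
  let o := RatCode.ofInt 1
  let zeros : VecCode := I.1.map fun _ => z
  let κ := RatCode.sub (RatCode.sub I.2.2.2.2 (RatCode.mul l I.2.2.2.1)) l
  (z :: z :: κ :: I.2.1) :: (z :: z :: z :: zeros) :: (z :: o :: o :: zeros) ::
    List.zipWith (fun x r => z :: x :: x :: r)
      (List.zipWith RatCode.sub (I.1.map fun _ => l) I.2.2.1) I.1

/-- The code denotes an instance of the exact value problem. -/
abbrev IsValid (I : ExactValueCode) : Prop :=
  I.1.IsStochastic ∧ VecCode.IsProb I.2.1 I.1.length ∧ VecCode.IsValid I.2.2.1 I.1.length ∧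
    0 < I.2.2.2.1.2 ∧ 0 < I.2.2.2.2.2

/-- The reduction from the exact value problem to Positivity on valid codes. A positive `T` is at
most the numerator in its code, so the largest slope up to that numerator takes all times that
precede `T` into account. -/
def toPositivity (I : ExactValueCode) : IntMatCode :=
  if I.2.2.2.1.1 < 0 then []
  else if I.2.2.2.1.1 = 0 then
    if RatCode.Lt (VecCode.dot I.2.1 I.2.2.1) I.2.2.2.2 then [[0, 1], [0, 0]] else []
  else (I.differenceCode (I.maxSlope I.2.2.2.1.1.toNat)).clearDenominators

section Primrec

theorem primrec_M : Primrec fun I : ExactValueCode => I.1 := .fst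

theorem primrec_μ : Primrec fun I : ExactValueCode => I.2.1 := Primrec.fst.comp .snd

theorem primrec_w : Primrec fun I : ExactValueCode => I.2.2.1 :=
  Primrec.fst.comp (Primrec.snd.comp .snd)

theorem primrec_T : Primrec fun I : ExactValueCode => I.2.2.2.1 :=
  Primrec.fst.comp (Primrec.snd.comp (Primrec.snd.comp .snd))

theorem primrec_θ : Primrec fun I : ExactValueCode => I.2.2.2.2 :=
  Primrec.snd.comp (Primrec.snd.comp (Primrec.snd.comp .snd))

theorem primrec_cumulativeReward : Primrec₂ cumulativeReward :=
  Primrec.nat_rec (f := fun I : ExactValueCode => I.2.2.1)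
    (g := fun I p => List.zipWith RatCode.add I.2.2.1 (MatCode.mulVec I.1 p.2)) primrec_w
    ((Primrec.list_zipWith RatCode.primrec_add).comp (primrec_w.comp .fst)
      (MatCode.primrec_mulVec.comp (primrec_M.comp .fst) (Primrec.snd.comp .snd)))

theorem primrec_utility : Primrec₂ utility :=
  VecCode.primrec_dot.comp (primrec_μ.comp .fst) primrec_cumulativeReward

theorem primrec_slope : Primrec₂ slope :=
  RatCode.primrec_div.comp (RatCode.primrec_sub.comp (primrec_θ.comp .fst) primrec_utility)
    (RatCode.primrec_sub.comp (primrec_T.comp .fst)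
      (RatCode.primrec_ofInt.comp (Primrec.int_ofNat.comp .snd)))

theorem primrec_maxSlope : Primrec₂ maxSlope :=
  Primrec.nat_rec (f := fun I : ExactValueCode => I.slope 0)
    (g := fun I p => if RatCode.Lt (RatCode.ofInt (p.1 + 1 : ℕ)) I.2.2.2.1 then
      RatCode.sup p.2 (I.slope (p.1 + 1)) else p.2)
    (primrec_slope.comp .id (.const 0))
    (Primrec.ite (RatCode.primrec_lt.comp (RatCode.primrec_ofInt.comp (Primrec.int_ofNat.comp
        (Primrec.succ.comp (Primrec.fst.comp .snd)))) (primrec_T.comp .fst))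
      (RatCode.primrec_sup.comp (Primrec.snd.comp .snd)
        (primrec_slope.comp .fst (Primrec.succ.comp (Primrec.fst.comp .snd))))
      (Primrec.snd.comp .snd))

theorem primrec_differenceCode : Primrec₂ differenceCode := by
  have hM : Primrec fun p : ExactValueCode × RatCode => p.1.1 := primrec_M.comp .fst
  have hz : Primrec fun p : ExactValueCode × RatCode => p.1.1.map fun _ => RatCode.ofInt 0 :=
    Primrec.list_map hM (Primrec.const _).to₂
  have hw : Primrec fun p : ExactValueCode × RatCode =>
      List.zipWith RatCode.sub (p.1.1.map fun _ => p.2) p.1.2.2.1 :=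
    (Primrec.list_zipWith RatCode.primrec_sub).comp
      (Primrec.list_map hM (Primrec.snd.comp .fst)) (primrec_w.comp .fst)
  have hκ : Primrec fun p : ExactValueCode × RatCode =>
      RatCode.sub (RatCode.sub p.1.2.2.2.2 (RatCode.mul p.2 p.1.2.2.2.1)) p.2 :=
    RatCode.primrec_sub.comp (RatCode.primrec_sub.comp (primrec_θ.comp .fst)
      (RatCode.primrec_mul.comp .snd (primrec_T.comp .fst))) .snd
  have hcons : Primrec₂ fun (x : RatCode) (r : List RatCode) => RatCode.ofInt 0 :: x :: x :: r :=
    Primrec.list_cons.comp (.const _)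
      (Primrec.list_cons.comp .fst (Primrec.list_cons.comp .fst .snd))
  exact Primrec.list_cons.comp
    (Primrec.list_cons.comp (.const _) (Primrec.list_cons.comp (.const _)
      (Primrec.list_cons.comp hκ (primrec_μ.comp .fst))))
    (Primrec.list_cons.comp
      (hcons.comp (.const _) hz)
      (Primrec.list_cons.comp (hcons.comp (.const _) hz)
        ((Primrec.list_zipWith hcons).comp hw hM)))

theorem primrec_isValid : PrimrecPred IsValid :=
  (MatCode.primrec_isStochastic.comp primrec_M).and
  ((VecCode.primrec_isProb.comp primrec_μ (Primrec.list_length.comp primrec_M)).and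
  ((VecCode.primrec_isValid.comp primrec_w (Primrec.list_length.comp primrec_M)).and
  ((Primrec.nat_lt.comp (.const 0) (Primrec.snd.comp primrec_T)).and
    (Primrec.nat_lt.comp (.const 0) (Primrec.snd.comp primrec_θ)))))

theorem primrec_toPositivity : Primrec toPositivity :=
  Primrec.ite (Primrec.int_lt.comp (Primrec.fst.comp primrec_T) (.const 0)) (.const [])
    (Primrec.ite (Primrec.eq.comp (Primrec.fst.comp primrec_T) (.const 0))
      (Primrec.ite (RatCode.primrec_lt.comp (VecCode.primrec_dot.comp primrec_μ primrec_w)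
          primrec_θ)
        (.const _) (.const []))
      (MatCode.primrec_clearDenominators.comp (primrec_differenceCode.comp .id
        (primrec_maxSlope.comp .id (Primrec.int_toNat.comp (Primrec.fst.comp primrec_T))))))

end Primrec

section Denotes

variable {I : ExactValueCode} {n : ℕ} {C : MarkovChain n} {T θ : ℚ}

theorem cumulativeReward_denotes (hM : I.1.Denotes C.M) (hw : I.2.2.1.Denotes C.w) (k : ℕ) :
    (I.cumulativeReward k).Denotes
      (∑ i ∈ Finset.range (k + 1), (C.M ^ i).mulVec C.w : Fin n → ℚ) := by
  induction k with
  | zero => simpa [cumulativeReward] using hw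
  | succ k ih =>
    have h : (∑ i ∈ Finset.range (k + 1 + 1), (C.M ^ i).mulVec C.w : Fin n → ℚ) =
        C.w + C.M.mulVec (∑ i ∈ Finset.range (k + 1), (C.M ^ i).mulVec C.w) := by
      rw [Finset.sum_range_succ', add_comm, Matrix.mulVec_sum]
      simp [Matrix.mulVec_mulVec, pow_succ']
    rw [h]
    exact hw.add (hM.mulVec ih)

theorem utility_denotes (hM : I.1.Denotes C.M) (hμ : I.2.1.Denotes C.μ)
    (hw : I.2.2.1.Denotes C.w) (k : ℕ) : (I.utility k).Denotes (C.utility k) := by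
  have h : C.utility k = C.μ ⬝ᵥ ∑ i ∈ Finset.range (k + 1), (C.M ^ i).mulVec C.w := by
    simp [MarkovChain.utility, dotProduct_sum, Matrix.dotProduct_mulVec]
  rw [h]
  exact hμ.dot (cumulativeReward_denotes hM hw k)

theorem slope_denotes (hM : I.1.Denotes C.M) (hμ : I.2.1.Denotes C.μ)
    (hw : I.2.2.1.Denotes C.w) (hT : I.2.2.2.1.Denotes T) (hθ : I.2.2.2.2.Denotes θ) {k : ℕ}
    (hk : k < T) : (I.slope k).Denotes ((θ - C.utility k) / (T - k)) :=
  (hθ.sub (utility_denotes hM hμ hw k)).div (hT.sub (by exact_mod_cast RatCode.denotes_ofInt k))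
    (by linarith)

/-- The number coded by `maxSlope` is the maximum of the slopes: a bound that is attained. -/
theorem exists_maxSlope_denotes (hM : I.1.Denotes C.M) (hμ : I.2.1.Denotes C.μ)
    (hw : I.2.2.1.Denotes C.w) (hT : I.2.2.2.1.Denotes T) (hθ : I.2.2.2.2.Denotes θ) (hT0 : 0 < T)
    (k : ℕ) : ∃ l, (I.maxSlope k).Denotes l ∧
      (∀ j : ℕ, j ≤ k → (j : ℚ) < T → (θ - C.utility j) / (T - j) ≤ l) ∧
      ∃ j : ℕ, (j : ℚ) < T ∧ (θ - C.utility j) / (T - j) = l := by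
  have hs := fun {k : ℕ} => slope_denotes (k := k) hM hμ hw hT hθ
  induction k with
  | zero =>
    refine ⟨_, hs (k := 0) (by simpa using hT0), fun j hj _ => ?_, 0, by simpa using hT0, rfl⟩
    obtain rfl := Nat.le_zero.1 hj
    exact le_rfl
  | succ k ih =>
    obtain ⟨l, h1, h2, j, hj, h3⟩ := ih
    have hlt : ((k + 1 : ℕ) : ℚ) < T ↔ RatCode.Lt (RatCode.ofInt (k + 1 : ℕ)) I.2.2.2.1 :=
      RatCode.Denotes.lt_iff (by exact_mod_cast RatCode.denotes_ofInt (k + 1 : ℕ)) hT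
    have hstep : I.maxSlope (k + 1) =
        if RatCode.Lt (RatCode.ofInt (k + 1 : ℕ)) I.2.2.2.1 then
          RatCode.sup (I.maxSlope k) (I.slope (k + 1)) else I.maxSlope k := rfl
    rw [hstep]
    split_ifs with hif
    · have hk := hlt.2 hif
      refine ⟨_, h1.sup (hs hk), fun i hi hiT => ?_, ?_⟩
      · rcases Nat.le_succ_iff.1 hi with hi | rfl
        · exact (h2 i hi hiT).trans (le_max_left _ _)
        · exact le_max_right _ _
      · rcases max_choice l ((θ - C.utility (k + 1)) / (T - (k + 1 : ℕ))) with h | h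
        · exact ⟨j, hj, h3.trans h.symm⟩
        · exact ⟨k + 1, hk, h.symm⟩
    · refine ⟨l, h1, fun i hi hiT => ?_, j, hj, h3⟩
      rcases Nat.le_succ_iff.1 hi with hi | rfl
      · exact h2 i hi hiT
      · exact (hif (hlt.1 hiT)).elim

theorem differenceCode_denotes (hM : I.1.Denotes C.M) (hμ : I.2.1.Denotes C.μ)
    (hw : I.2.2.1.Denotes C.w) (hT : I.2.2.2.1.Denotes T) (hθ : I.2.2.2.2.Denotes θ)
    {a : RatCode} {l : ℚ} (ha : a.Denotes l) :
    (I.differenceCode a).Denotes (C.differenceMatrix T θ l) := by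
  have h0 := RatCode.denotes_zero
  have h1 := RatCode.denotes_one
  have hz := VecCode.denotes_const_map h0 hM.length_eq
  rw [MatCode.denotes_iff]
  refine List.Forall₂.cons_ofFn ?_ (List.Forall₂.cons_ofFn ?_ (List.Forall₂.cons_ofFn ?_ ?_))
  · exact ((hμ.cons ((hθ.sub (ha.mul hT)).sub ha)).cons h0).cons h0
  · exact ((hz.cons h0).cons h0).cons h0
  · exact ((hz.cons h1).cons h1).cons h0
  · exact List.Forall₂.zipWith_ofFn ((VecCode.denotes_const_map ha hM.length_eq).sub hw)
      (MatCode.denotes_iff.1 hM) fun x r i hx hr =>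
        ((VecCode.Denotes.cons hx hr).cons hx).cons h0

theorem positivityProblem_toPositivity_iff (hM : I.1.Denotes C.M) (hμ : I.2.1.Denotes C.μ)
    (hw : I.2.2.1.Denotes C.w) (hT : I.2.2.2.1.Denotes T) (hθ : I.2.2.2.2.Denotes θ) :
    PositivityProblem I.toPositivity ↔ C.val (T : ℝ) < ((θ : ℝ) : EReal) := by
  have hnil : ¬ PositivityProblem [] := by
    rintro ⟨n, M, h, -⟩
    simpa using h.length_eq
  have hval_zero : I.2.2.2.1.1 = 0 → (C.val (T : ℝ) < ((θ : ℝ) : EReal) ↔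
      RatCode.Lt (VecCode.dot I.2.1 I.2.2.1) I.2.2.2.2) := fun hzero => by
    have hu : C.utility 0 = C.μ ⬝ᵥ C.w := by simp [MarkovChain.utility]
    rw [hT.zero_iff.2 hzero, Rat.cast_zero, C.val_zero_lt_iff, hu, (hμ.dot hw).lt_iff hθ]
  unfold toPositivity
  split_ifs with hneg hzero hlt
  · have hT0 : (T : ℝ) < 0 := by
      exact_mod_cast not_le.1 fun h => hneg.not_ge (hT.nonneg_iff.1 h)
    simp [C.val_of_neg hT0, hnil]
  · refine iff_of_true ?_ ((hval_zero hzero).2 hlt)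
    exact ⟨0, !![0, 1; 0, 0], by simp [IntMatCode.Denotes], 1, le_rfl, by simp⟩
  · exact iff_of_false hnil (hlt ∘ (hval_zero hzero).1)
  · have hpos : 0 < I.2.2.2.1.1 := lt_of_le_of_ne (not_lt.1 hneg) (Ne.symm hzero)
    have hT0 := hT.pos_iff.2 hpos
    obtain ⟨l, hl, hle, k, hk, hkl⟩ :=
      exists_maxSlope_denotes hM hμ hw hT hθ hT0 I.2.2.2.1.1.toNat
    obtain ⟨hd, N, hN, hNd⟩ := (differenceCode_denotes hM hμ hw hT hθ hl).clearDenominators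
    rw [positivityProblem_iff (n := n + 1) hN, C.exists_utility_lt_iff T θ l hd hNd,
      C.val_lt_iff (l := l)]
    · intro j hj
      have hjle : j ≤ I.2.2.2.1.1.toNat := by
        have h1 : T ≤ (I.2.2.2.1.1 : ℚ) := by
          rw [hT.2]
          exact div_le_self (by exact_mod_cast hpos.le) (by exact_mod_cast hT.1)
        have h2 : (j : ℤ) < I.2.2.2.1.1 := by exact_mod_cast hj.trans_le h1
        omega
      have := hle j hjle hj
      rw [div_le_iff₀ (by linarith)] at this
      linarith
    · refine ⟨k, hk, ?_⟩
      rw [div_eq_iff (by linarith)] at hkl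
      linarith

end Denotes

theorem isValid_iff {I : ExactValueCode} : I.IsValid ↔ ∃ (n : ℕ) (C : MarkovChain n) (T θ : ℚ),
    I.1.Denotes C.M ∧ I.2.1.Denotes C.μ ∧ I.2.2.1.Denotes C.w ∧ I.2.2.2.1.Denotes T ∧
      I.2.2.2.2.Denotes θ := by
  constructor
  · rintro ⟨hst, hpr, hval, hT, hθ⟩
    obtain ⟨M, hM⟩ := hst.exists_denotes rfl
    obtain ⟨μ, hμ⟩ := VecCode.exists_denotes_iff.2 hpr.1
    obtain ⟨w, hw⟩ := VecCode.exists_denotes_iff.2 hval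
    obtain ⟨T, hT⟩ := RatCode.exists_denotes_iff.2 hT
    obtain ⟨θ, hθ⟩ := RatCode.exists_denotes_iff.2 hθ
    obtain ⟨h0, h1⟩ := hμ.isProb_iff.1 hpr
    exact ⟨_, ⟨M, μ, w, hM.isStochastic_iff.1 hst, h0, h1⟩, T, θ, hM, hμ, hw, hT, hθ⟩
  · rintro ⟨n, C, T, θ, hM, hμ, hw, hT, hθ⟩
    obtain rfl := hM.length_eq
    exact ⟨hM.isStochastic_iff.2 C.stochastic, hμ.isProb_iff.2 ⟨C.μ_nonneg, C.μ_sum⟩, hw.isValid,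
      hT.1, hθ.1⟩

end ExactValueCode

theorem exactValue_reduces_to_positivity : ExactValueProblem ≤₀ PositivityProblem := by
  refine ⟨fun I => if I.IsValid then I.toPositivity else [],
    (Primrec.ite ExactValueCode.primrec_isValid ExactValueCode.primrec_toPositivity
      (.const _)).to_comp, fun I => ?_⟩
  dsimp only
  split_ifs with hI
  · obtain ⟨n, C, T, θ, hM, hμ, hw, hT, hθ⟩ := ExactValueCode.isValid_iff.1 hI
    exact (exactValueProblem_iff hM hμ hw hT hθ).trans
      (ExactValueCode.positivityProblem_toPositivity_iff hM hμ hw hT hθ).symm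
  · constructor
    · rintro ⟨n, C, T, θ, hM, hμ, hw, hT, hθ, -⟩
      exact (hI (ExactValueCode.isValid_iff.2 ⟨n, C, T, θ, hM, hμ, hw, hT, hθ⟩)).elim
    · rintro ⟨n, M, h, -⟩
      simpa using h.length_eq

theorem mainTheorem1 :
    ManyOneEquiv PositivityProblem MarkovReachabilityProblem ∧
    ManyOneEquiv MarkovReachabilityProblem ExactValueProblem ∧
    ManyOneEquiv PositivityProblem ExactValueProblem := by
  have hPR := positivity_reduces_to_markovReachability
  have hRE := markovReachability_reduces_to_exactValue
  have hEP := exactValue_reduces_to_positivity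
  exact ⟨⟨hPR, hRE.trans hEP⟩, ⟨hRE, hEP.trans hPR⟩, ⟨hPR.trans hRE, hEP⟩⟩
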